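/- Let $T$ be a strongly continuous, non-trivial, irreducible unitary representation of $SL(2,\mathbb R)$ on a complex separable Hilbert space $\mathcal H$. Put $$r(\theta)=\begin{pmatrix}\cos\theta&\sin\theta\\-\sin\theta&\cos\theta\end{pmatrix},\quad a(t)=\begin{pmatrix}e^t&0\\0&e^{-t}\end{pmatrix},\quad W=\begin{pmatrix}0&1\\-1&0\end{pmatrix},\quad Q=\begin{pmatrix}1&0\\0&-1\end{pmatrix},\quad V=\begin{pmatrix}0&1\\1&0\end{pmatrix}.$$ For $X\in\{W,Q,V\}$ let $L_Xv=\lim_{t\to0}\frac{T(\exp(tX))v-v}{t}$, and let $\Omega_T=(L_V^2+L_Q^2-L_W^2)/4$ be the Casimir operator on the $C^2$-vectors of $T$ (the $v\in\mathcal H$ for which $g\mapsto T(g)v$ is $C^2$). Let $\mathcal H_n=\{v\in\mathcal H: T(r(\theta))v=e^{in\theta}v\ \ \forall\theta\in\mathbb R\}$ for $n\in\mathbb Z$, and let $(\phi_n)_{n\in\mathbb Z}$ be a family with $\phi_n\in\mathcal H_n$, with $\phi_n\neq0$ if and only if $\dim\mathcal H_n=1$, and whose non-zero members form an orthonormal basis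 of $\mathcal H$. Let $B_{n,m}(t)=\langle\phi_n,T(a(t))\phi_m\rangle$. Then there is a unique $\lambda=\lambda(T)\in\mathbb R$ such that $\Omega_Tv=\lambda v$ for every $C^2$-vector $v$, and for all $n,m\in\mathbb Z$ and all $t\ge1$ $$|B_{n,m}(t)|\le\bigl(\bar K_\lambda(m^2+n^2)+\tilde K_\lambda\bigr)\,b_\lambda(t),$$ where $$C_1=\frac1{1-e^{-4}},\qquad C_2=\frac{2}{1-e^{-4}}\left(1+\frac{2}{e^2(1-e^{-4})}+\frac{2}{e^4(1-e^{-4})}\right),$$ $$\bar K_\lambda=\begin{cases}\dfrac{4C_1}{9e^3}+\dfrac{2C_2}{e}+e&\text{if }\lambda<0,\\[2mm]\dfrac{C_1+C_2}2&\text{if }\lambda\ge0,\end{cases}\qquad \tilde K_\lambda=\begin{cases}(1+2\sqrt2)e+\dfrac{(32+\sqrt2)C_1^2}{3e^3}&\text{if }\lambda\le-\frac14,\\[2mm]3e+e^2+\dfrac{4C_1}{9e^3}&\text{if }-\frac14<\lambda<0,\\[2mm]e^2&\text{if }\lambda\ge0,\end{cases}$$ $$b_\lambda(t)=\begin{cases}te^{-t}&\text{if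 }\lambda\le-\frac14,\\ te^{(-1+\sqrt{1+4\lambda})t}&\text{if }-\frac14<\lambda<0,\\ te^{-2t}&\text{if }\lambda\ge0.\end{cases}$$ -/

import Mathlib

open scoped MatrixGroups

noncomputable section

namespace Ratner

/-! ### One-parameter subgroups of `SL(2, ℝ)` -/

/-- `r(θ)`, the rotation subgroup. -/
def rot (θ : ℝ) : SL(2, ℝ) :=
  ⟨!![Real.cos θ, Real.sin θ; -Real.sin θ, Real.cos θ], by
    rw [Matrix.det_fin_two_of]; nlinarith [Real.sin_sq_add_cos_sq θ]⟩

/-- `a(t)`, the positive diagonal subgroup. -/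
def diag (t : ℝ) : SL(2, ℝ) :=
  ⟨!![Real.exp t, 0; 0, Real.exp (-t)], by
    rw [Matrix.det_fin_two_of, ← Real.exp_add]; simp⟩

/-- The hyperbolic subgroup generated by the symmetric matrix `V`. -/
def hyp (t : ℝ) : SL(2, ℝ) :=
  ⟨!![Real.cosh t, Real.sinh t; Real.sinh t, Real.cosh t], by
    rw [Matrix.det_fin_two_of]; nlinarith [Real.cosh_sq_sub_sinh_sq t]⟩

/-- The basis `W`, `Q`, `V` of the Lie algebra of trace zero matrices. -/
def matW : Matrix (Fin 2) (Fin 2) ℝ := !![0, 1; -1, 0]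

def matQ : Matrix (Fin 2) (Fin 2) ℝ := !![1, 0; 0, -1]

def matV : Matrix (Fin 2) (Fin 2) ℝ := !![0, 1; 1, 0]

theorem eq_exp_of_hasDerivAt_aux {A : Type*} [NormedRing A] [NormedAlgebra ℝ A] [CompleteSpace A]
    (X : A) (M : ℝ → A) (h0 : M 0 = 1) (hM : ∀ t, HasDerivAt M (X * M t) t) (t : ℝ) :
    M t = NormedSpace.exp (t • X) := by
  let _ : NormedAlgebra ℚ A := NormedAlgebra.restrictScalars ℚ ℝ A
  have hE : ∀ t : ℝ, HasDerivAt (fun s : ℝ => NormedSpace.exp (s • (-X)))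
      (NormedSpace.exp (t • (-X)) * (-X)) t := fun t => hasDerivAt_exp_smul_const (-X) t
  have hP : ∀ t : ℝ, HasDerivAt (fun s : ℝ => NormedSpace.exp (s • (-X)) * M s) 0 t := by
    intro t
    refine ((hE t).fun_mul (hM t)).congr_deriv ?_
    rw [mul_neg, neg_mul, mul_assoc, neg_add_cancel]
  have hc := is_const_of_deriv_eq_zero (fun s => (hP s).differentiableAt)
    (fun s => (hP s).deriv) t 0
  simp only [zero_smul, NormedSpace.exp_zero, h0, mul_one] at hc
  have hinv : NormedSpace.exp (t • X) * NormedSpace.exp (t • (-X)) = 1 := by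
    rw [smul_neg, ← NormedSpace.exp_add_of_commute (Commute.neg_right (Commute.refl _)),
      add_neg_cancel, NormedSpace.exp_zero]
  calc M t = NormedSpace.exp (t • X) * (NormedSpace.exp (t • (-X)) * M t) := by
        rw [← mul_assoc, hinv, one_mul]
    _ = _ := by rw [hc, mul_one]

/-- A matrix curve with `M' = X M` and `M 0 = 1` is `t ↦ exp (t X)`. -/
theorem eq_exp_of_hasDerivAt (X : Matrix (Fin 2) (Fin 2) ℝ)
    (M : ℝ → Matrix (Fin 2) (Fin 2) ℝ) (h0 : M 0 = 1)
    (hM : ∀ t i j, HasDerivAt (fun s => M s i j) ((X * M t) i j) t) (t : ℝ) :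
    M t = NormedSpace.exp (t • X) := by
  let _ : NormedRing (Matrix (Fin 2) (Fin 2) ℝ) := Matrix.linftyOpNormedRing
  let _ : NormedAlgebra ℝ (Matrix (Fin 2) (Fin 2) ℝ) := Matrix.linftyOpNormedAlgebra
  exact eq_exp_of_hasDerivAt_aux X M h0
    (fun t => hasDerivAt_pi.2 fun i => hasDerivAt_pi.2 fun j => hM t i j) t

theorem rot_eq_exp (t : ℝ) : (rot t).1 = NormedSpace.exp (t • matW) := by
  refine eq_exp_of_hasDerivAt matW (fun t => (rot t).1) ?_ ?_ t
  · ext i j; fin_cases i <;> fin_cases j <;> simp [rot]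
  · intro t i j
    fin_cases i <;> fin_cases j <;>
      simp [rot, matW, Matrix.mul_apply, Fin.sum_univ_two, Real.hasDerivAt_sin,
        Real.hasDerivAt_cos, (Real.hasDerivAt_sin t).fun_neg]

theorem diag_eq_exp (t : ℝ) : (diag t).1 = NormedSpace.exp (t • matQ) := by
  refine eq_exp_of_hasDerivAt matQ (fun t => (diag t).1) ?_ ?_ t
  · ext i j; fin_cases i <;> fin_cases j <;> simp [diag]
  · intro t i j
    have h := (Real.hasDerivAt_exp (-t)).scomp t (hasDerivAt_neg t)
    fin_cases i <;> fin_cases j <;>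
      simp [diag, matQ, Matrix.mul_apply, Fin.sum_univ_two, Real.hasDerivAt_exp,
        hasDerivAt_const]
    simpa [Function.comp_def] using h

theorem hyp_eq_exp (t : ℝ) : (hyp t).1 = NormedSpace.exp (t • matV) := by
  refine eq_exp_of_hasDerivAt matV (fun t => (hyp t).1) ?_ ?_ t
  · ext i j; fin_cases i <;> fin_cases j <;> simp [hyp]
  · intro t i j
    fin_cases i <;> fin_cases j <;>
      simp [hyp, matV, Matrix.mul_apply, Fin.sum_univ_two, Real.hasDerivAt_sinh,
        Real.hasDerivAt_cosh]

/-! ### Unitary representations -/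

variable {H : Type*} [NormedAddCommGroup H] [InnerProductSpace ℂ H]

/-- Strong continuity of a representation by unitary operators. -/
def IsStronglyContinuous (T : SL(2, ℝ) →* (H ≃ₗᵢ[ℂ] H)) : Prop :=
  ∀ v : H, Continuous fun g : SL(2, ℝ) => T g v

/-- Topological irreducibility: the space is nonzero and its only closed invariant subspaces are
zero and the whole space. -/
def IsIrreducible (T : SL(2, ℝ) →* (H ≃ₗᵢ[ℂ] H)) : Prop :=
  Nontrivial H ∧ ∀ S : Submodule ℂ H, IsClosed (S : Set H) →
    (∀ g : SL(2, ℝ), ∀ v ∈ S, T g v ∈ S) → S = ⊥ ∨ S = ⊤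

/-- `v` is a `C^k`-vector: the orbit map `g ↦ T g v` is `C^k` on the embedded submanifold `SL(2, ℝ)`
of the space of real `2 × 2` matrices, i.e. it is the restriction of a map that is `C^k` near
every point of `SL(2, ℝ)`. -/
def IsCkVector (T : SL(2, ℝ) →* (H ≃ₗᵢ[ℂ] H)) (k : ℕ) (v : H) : Prop :=
  ∃ F : (Fin 2 → Fin 2 → ℝ) → H,
    ∀ g : SL(2, ℝ), ContDiffAt ℝ k F (fun i j => g i j) ∧ F (fun i j => g i j) = T g v

/-- The Lie derivative of `v` along a one-parameter subgroup `γ`,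
the limit of `(T (γ t) v - v) / t` as `t → 0`. -/
def lieDeriv (T : SL(2, ℝ) →* (H ≃ₗᵢ[ℂ] H)) (γ : ℝ → SL(2, ℝ)) (v : H) : H :=
  deriv (fun t : ℝ => T (γ t) v) 0

/-- The Casimir operator `(L_V² + L_Q² - L_W²) / 4`, to be applied to `C²`-vectors. -/
def casimir (T : SL(2, ℝ) →* (H ≃ₗᵢ[ℂ] H)) (v : H) : H :=
  (1 / 4 : ℂ) • (lieDeriv T hyp (lieDeriv T hyp v) + lieDeriv T diag (lieDeriv T diag v)
    - lieDeriv T rot (lieDeriv T rot v))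

/-- `lam` is the Casimir parameter `λ(T)`: one has `Ω v = lam v` for every `C²`-vector `v`. -/
def IsCasimirParameter (T : SL(2, ℝ) →* (H ≃ₗᵢ[ℂ] H)) (lam : ℝ) : Prop :=
  ∀ v : H, IsCkVector T 2 v → casimir T v = (lam : ℂ) • v

/-- The `K`-type space `H_n = {v | T (r θ) v = exp (i n θ) v for all θ}`. -/
def kTypeSpace (T : SL(2, ℝ) →* (H ≃ₗᵢ[ℂ] H)) (n : ℤ) : Submodule ℂ H where
  carrier := {v | ∀ θ : ℝ, T (rot θ) v = Complex.exp (Complex.I * n * θ) • v}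
  add_mem' := by
    intro v w hv hw θ
    rw [map_add, hv θ, hw θ, smul_add]
  zero_mem' := by
    intro θ
    simp
  smul_mem' := by
    intro c v hv θ
    rw [map_smul, hv θ, smul_comm]

/-- A family `(φ_n)` with `φ_n ∈ H_n`, `φ_n ≠ 0` exactly when `dim H_n = 1`, whose nonzero members
form an orthonormal basis of the Hilbert space. -/
structure IsKTypeBasis (T : SL(2, ℝ) →* (H ≃ₗᵢ[ℂ] H)) (φ : ℤ → H) : Prop where
  mem : ∀ n, φ n ∈ kTypeSpace T n
  ne_zero_iff : ∀ n, φ n ≠ 0 ↔ Module.finrank ℂ (kTypeSpace T n) = 1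
  orthonormal : Orthonormal ℂ (fun n : {n : ℤ // φ n ≠ 0} => φ n)
  total : (Submodule.span ℂ (Set.range φ)).topologicalClosure = ⊤

/-- The matrix coefficient `B_{n,m}(t) = ⟨φ_n, T(a(t)) φ_m⟩`. -/
def coeff (T : SL(2, ℝ) →* (H ≃ₗᵢ[ℂ] H)) (φ : ℤ → H) (n m : ℤ) (t : ℝ) : ℂ :=
  inner ℂ (φ n) (T (diag t) (φ m))

/-! ### Explicit constants -/

def C1 : ℝ := (1 - Real.exp (-4))⁻¹

def C2 : ℝ := 2 / (1 - Real.exp (-4)) *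
  (1 + 2 / (Real.exp 2 * (1 - Real.exp (-4))) + 2 / (Real.exp 4 * (1 - Real.exp (-4))))

/-- The constant multiplying `m² + n²`; it is the same for `lam ≤ -1/4` and `-1/4 < lam < 0`. -/
def Kbar (lam : ℝ) : ℝ :=
  if lam < 0 then 4 * C1 / (9 * Real.exp 3) + 2 * C2 / Real.exp 1 + Real.exp 1
  else (C1 + C2) / 2

def Ktilde (lam : ℝ) : ℝ :=
  if lam ≤ -1 / 4 then
    (1 + 2 * √2) * Real.exp 1 + (32 + √2) * C1 ^ 2 / (3 * Real.exp 3)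
  else if lam < 0 then
    3 * Real.exp 1 + Real.exp 2 + 4 * C1 / (9 * Real.exp 3)
  else Real.exp 2

def b (lam t : ℝ) : ℝ :=
  if lam ≤ -1 / 4 then t * Real.exp (-t)
  else if lam < 0 then t * Real.exp ((-1 + √(1 + 4 * lam)) * t)
  else t * Real.exp (-2 * t)

end Ratner

end

/-! Existence of `λ`. The Casimir operator commutes with the group (`casimir_apply`) and is
symmetric (`inner_casimir`). Averaging the orbit of a non-zero `φ n` against a suitable smooth
function gives a smooth vector of the same `K`-type not orthogonal to `φ n`
(`exists_isCkVector_inner_ne_zero`); the `K`-type being one-dimensional, `φ n` itself is smooth. It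
is then a Casimir eigenvector with real eigenvalue `λ`. For any `C²`-vector `v`, `Ω v - λ v` is
orthogonal to the orbit of `φ n`, hence zero by irreducibility.

The estimate. On `B = B_{n,m}` the Casimir equation becomes the radial equation `B'' + 2 coth(2t) B'
= (4λ + (n² + m² - 2mn cosh 2t) / sinh² 2t) B` (`ode_of_isCasimirParameter`). With `weight t = √(2
sinh 2t)`, which is comparable to `e^t`, the function `z = weight · B` solves `z'' = (1 + 4λ + r)
z`, where `r` is `O(e^{-2t})` with a constant linear in `n² + m²`. Since `|B| ≤ 1`, the term `r z`
is `O(e^{-t})` a priori, so it can be treated as a known forcing term of a constant-coefficient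
equation.

For `λ < 0`, variation of constants from `t = 1` gives `z = O(t e^{√(1+4λ) t})`, the root being `0`
when `λ ≤ -1/4`; the initial derivative is controlled by the norm of `L_Q φ_m`, which the Casimir
equation bounds (`norm_lieDeriv_diag_sq_le`). For `λ ≥ 0` the growing mode `e^{√(1+4λ) t}` must be
excluded: `B` and `B'` tend to zero by a Mautner argument (`tendsto_inner_diag_atTop`), so
integrating back from infinity gives `z = O(t e^{-t})` and `B = O(t e^{-2t})`. The stated constants
are then reached by numerical comparison. -/

namespace Ratner

/-! ### The group inside the space of matrices -/

/-- The normed space of real `2 × 2` matrices. -/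
abbrev Mat2 : Type := Fin 2 → Fin 2 → ℝ

/-- The matrix of an element of `SL(2, ℝ)`. -/
def entries (g : SL(2, ℝ)) : Mat2 := fun i j => g i j

/-- Matrix multiplication. -/
def mulMat (A B : Mat2) : Mat2 := fun i j => A i 0 * B 0 j + A i 1 * B 1 j

theorem entries_mul (g h : SL(2, ℝ)) : entries (g * h) = mulMat (entries g) (entries h) := by
  funext i j
  simp [entries, mulMat, Matrix.mul_apply, Fin.sum_univ_two]

theorem one_mulMat (A : Mat2) : mulMat (entries 1) A = A := by
  funext i j
  fin_cases i <;> simp [entries, mulMat]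

/-- Right multiplication by `X`. -/
noncomputable def mulRightL (X : Mat2) : Mat2 →L[ℝ] Mat2 :=
  LinearMap.toContinuousLinearMap
    { toFun := fun A => mulMat A X
      map_add' := fun A B => by funext i j; simp only [mulMat, Pi.add_apply]; ring
      map_smul' := fun c A => by
        funext i j; simp only [mulMat, Pi.smul_apply, smul_eq_mul, RingHom.id_apply]; ring }

/-- Left multiplication by `X`. -/
noncomputable def mulLeftL (X : Mat2) : Mat2 →L[ℝ] Mat2 :=
  LinearMap.toContinuousLinearMap
    { toFun := fun A => mulMat X A
      map_add' := fun A B => by funext i j; simp only [mulMat, Pi.add_apply]; ring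
      map_smul' := fun c A => by
        funext i j; simp only [mulMat, Pi.smul_apply, smul_eq_mul, RingHom.id_apply]; ring }

@[simp] theorem mulRightL_apply (X A : Mat2) : mulRightL X A = mulMat A X := rfl

@[simp] theorem mulLeftL_apply (X A : Mat2) : mulLeftL X A = mulMat X A := rfl

/-- `γ` is a one-parameter subgroup with tangent vector `X`. -/
structure IsOneParam (γ : ℝ → SL(2, ℝ)) (X : Mat2) : Prop where
  zero : γ 0 = 1
  add : ∀ s t, γ (s + t) = γ s * γ t
  deriv : HasDerivAt (fun s => entries (γ s)) X 0

/-- The tangent vector of `rot`. -/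
def tanW : Mat2 := ![![0, 1], ![-1, 0]]

/-- The tangent vector of `diag`. -/
def tanQ : Mat2 := ![![1, 0], ![0, -1]]

/-- The tangent vector of `hyp`. -/
def tanV : Mat2 := ![![0, 1], ![1, 0]]

theorem entries_injective : Function.Injective entries := fun g h hgh => by
  ext i j
  exact congrFun (congrFun hgh i) j

theorem entries_rot (t : ℝ) :
    entries (rot t) = ![![Real.cos t, Real.sin t], ![-Real.sin t, Real.cos t]] := rfl

theorem entries_diag (t : ℝ) : entries (diag t) = ![![Real.exp t, 0], ![0, Real.exp (-t)]] := rfl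

theorem entries_hyp (t : ℝ) :
    entries (hyp t) = ![![Real.cosh t, Real.sinh t], ![Real.sinh t, Real.cosh t]] := rfl

theorem isOneParam_rot : IsOneParam rot tanW where
  zero := by ext i j; fin_cases i <;> fin_cases j <;> simp [rot]
  add s t := by
    refine entries_injective ?_
    rw [entries_mul]
    funext i j
    fin_cases i <;> fin_cases j <;>
      simp [entries_rot, mulMat, Real.cos_add, Real.sin_add] <;> ring
  deriv := by
    refine hasDerivAt_pi.2 fun i => hasDerivAt_pi.2 fun j => ?_
    have h1 := Real.hasDerivAt_sin 0
    have h2 := Real.hasDerivAt_cos 0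
    have h3 := (Real.hasDerivAt_sin 0).fun_neg
    simp only [Real.cos_zero, Real.sin_zero, neg_zero] at h1 h2 h3
    fin_cases i <;> fin_cases j <;> simpa [entries_rot, tanW]

theorem isOneParam_diag : IsOneParam diag tanQ where
  zero := by ext i j; fin_cases i <;> fin_cases j <;> simp [diag]
  add s t := by
    refine entries_injective ?_
    rw [entries_mul]
    funext i j
    fin_cases i <;> fin_cases j <;> simp [entries_diag, mulMat, ← Real.exp_add]
    ring
  deriv := by
    refine hasDerivAt_pi.2 fun i => hasDerivAt_pi.2 fun j => ?_
    have h1 := Real.hasDerivAt_exp 0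
    have h2 := (hasDerivAt_neg (0 : ℝ)).exp
    simp only [Real.exp_zero, neg_zero, one_mul] at h1 h2
    fin_cases i <;> fin_cases j <;> simp [entries_diag, tanQ, hasDerivAt_const] <;> assumption

theorem isOneParam_hyp : IsOneParam hyp tanV where
  zero := by ext i j; fin_cases i <;> fin_cases j <;> simp [hyp]
  add s t := by
    refine entries_injective ?_
    rw [entries_mul]
    funext i j
    fin_cases i <;> fin_cases j <;>
      simp [entries_hyp, mulMat, Real.cosh_add, Real.sinh_add] <;> ring
  deriv := by
    refine hasDerivAt_pi.2 fun i => hasDerivAt_pi.2 fun j => ?_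
    have h1 := Real.hasDerivAt_sinh 0
    have h2 := Real.hasDerivAt_cosh 0
    simp only [Real.cosh_zero, Real.sinh_zero] at h1 h2
    fin_cases i <;> fin_cases j <;> simpa [entries_hyp, tanV]

namespace IsOneParam

variable {γ : ℝ → SL(2, ℝ)} {X : Mat2}

theorem neg (h : IsOneParam γ X) (t : ℝ) : γ (-t) = (γ t)⁻¹ := by
  rw [eq_inv_iff_mul_eq_one, ← h.add, neg_add_cancel, h.zero]

theorem hasDerivAt_mul_left (h : IsOneParam γ X) (g : SL(2, ℝ)) :
    HasDerivAt (fun s => entries (g * γ s)) (mulMat (entries g) X) 0 := by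
  simp only [entries_mul]
  exact (mulLeftL (entries g)).hasFDerivAt.comp_hasDerivAt 0 h.deriv

theorem hasDerivAt_mul_right (h : IsOneParam γ X) (g : SL(2, ℝ)) :
    HasDerivAt (fun s => entries (γ s * g)) (mulMat X (entries g)) 0 := by
  simp only [entries_mul]
  exact (mulRightL (entries g)).hasFDerivAt.comp_hasDerivAt 0 h.deriv

end IsOneParam

/-! ### Lie derivatives in terms of an extension of the orbit map -/

variable {H : Type*} [NormedAddCommGroup H] [InnerProductSpace ℂ H]
  {T : SL(2, ℝ) →* (H ≃ₗᵢ[ℂ] H)}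

/-- `F` is a `C^k` extension of the orbit map of `v` to a neighbourhood of `SL(2, ℝ)`. -/
def IsOrbitExt (T : SL(2, ℝ) →* (H ≃ₗᵢ[ℂ] H)) (k : ℕ) (v : H) (F : Mat2 → H) : Prop :=
  ∀ g : SL(2, ℝ), ContDiffAt ℝ k F (entries g) ∧ F (entries g) = T g v

theorem isCkVector_iff (k : ℕ) (v : H) : IsCkVector T k v ↔ ∃ F, IsOrbitExt T k v F := Iff.rfl

namespace IsOrbitExt

variable {k : ℕ} {v : H} {F : Mat2 → H} {γ η : ℝ → SL(2, ℝ)} {X Y : Mat2}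

theorem mono {l : ℕ} (hF : IsOrbitExt T k v F) (h : l ≤ k) : IsOrbitExt T l v F :=
  fun g => ⟨(hF g).1.of_le (by exact_mod_cast h), (hF g).2⟩

theorem differentiableAt (hF : IsOrbitExt T 1 v F) (g : SL(2, ℝ)) :
    DifferentiableAt ℝ F (entries g) :=
  (hF g).1.differentiableAt (by simp)

theorem hasDerivAt (hF : IsOrbitExt T 1 v F) {c : ℝ → SL(2, ℝ)} {Z : Mat2} {s : ℝ}
    (hc : HasDerivAt (fun s => entries (c s)) Z s) :
    HasDerivAt (fun s => T (c s) v) (fderiv ℝ F (entries (c s)) Z) s := by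
  have h := (hF.differentiableAt (c s)).hasFDerivAt.comp_hasDerivAt s hc
  refine h.congr_of_eventuallyEq (Filter.Eventually.of_forall fun t => ?_)
  exact (hF (c t)).2.symm

theorem hasDerivAt_lieDeriv (hF : IsOrbitExt T 1 v F) (hγ : IsOneParam γ X) :
    HasDerivAt (fun s => T (γ s) v) (lieDeriv T γ v) 0 := by
  have h := hF.hasDerivAt hγ.deriv
  exact h.differentiableAt.hasDerivAt

/-- `T g` is continuous and linear, so it passes through the derivative, and `s ↦ g γ(s)` leaves `g`
with velocity `g X`. Lie derivatives thus become ordinary derivatives of `F` in the space of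
matrices. -/
theorem apply_lieDeriv (hF : IsOrbitExt T 1 v F) (hγ : IsOneParam γ X) (g : SL(2, ℝ)) :
    T g (lieDeriv T γ v) = fderiv ℝ F (entries g) (mulMat (entries g) X) := by
  have h1 := hF.hasDerivAt (hγ.hasDerivAt_mul_left g)
  have h2 := ((T g).toContinuousLinearEquiv.toContinuousLinearMap.restrictScalars
    ℝ).hasFDerivAt.comp_hasDerivAt (0 : ℝ) (hF.hasDerivAt_lieDeriv hγ)
  rw [hγ.zero, mul_one] at h1
  refine (h1.unique (h2.congr_of_eventuallyEq (Filter.Eventually.of_forall fun t => ?_))).symm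
  simp [map_mul]

theorem hasDerivAt_orbit (hF : IsOrbitExt T 1 v F) (hγ : IsOneParam γ X) (g : SL(2, ℝ)) (s : ℝ) :
    HasDerivAt (fun s => T (g * γ s) v) (T (g * γ s) (lieDeriv T γ v)) s := by
  have h := hF.hasDerivAt (hγ.hasDerivAt_mul_left (g * γ s))
  rw [hγ.zero, mul_one, ← hF.apply_lieDeriv hγ] at h
  have h2 : HasDerivAt (fun x : ℝ => x - s) 1 s := (hasDerivAt_id s).sub_const s
  rw [← sub_self s] at h
  have h3 := HasDerivAt.scomp (h := fun x => x - s) s h h2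
  rw [one_smul] at h3
  refine h3.congr_of_eventuallyEq (Filter.Eventually.of_forall fun x => ?_)
  simp [mul_assoc, ← hγ.add]

/-- The extension of the orbit map of a Lie derivative. -/
noncomputable def lieExt (F : Mat2 → H) (X : Mat2) : Mat2 → H :=
  fun A => fderiv ℝ F A (mulMat A X)

theorem lie (hF : IsOrbitExt T (k + 1) v F) (hγ : IsOneParam γ X) :
    IsOrbitExt T k (lieDeriv T γ v) (lieExt F X) := by
  intro g
  refine ⟨?_, ((hF.mono (by omega)).apply_lieDeriv hγ g).symm⟩
  have h := (hF g).1.fderiv_right (m := k) (by simp)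
  exact h.clm_apply (mulRightL X).contDiff.contDiffAt

theorem hasFDerivAt_fderiv (hF : IsOrbitExt T 2 v F) (g : SL(2, ℝ)) :
    HasFDerivAt (fderiv ℝ F) (fderiv ℝ (fderiv ℝ F) (entries g)) (entries g) :=
  (((hF g).1.fderiv_right (m := 1) (by norm_num)).differentiableAt (by simp)).hasFDerivAt

theorem fderiv_lieExt (hF : IsOrbitExt T 2 v F) (g : SL(2, ℝ)) (X Z : Mat2) :
    fderiv ℝ (lieExt F X) (entries g) Z =
      fderiv ℝ (fderiv ℝ F) (entries g) Z (mulMat (entries g) X) +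
        fderiv ℝ F (entries g) (mulMat Z X) := by
  have h := (hF.hasFDerivAt_fderiv g).clm_apply (mulRightL X).hasFDerivAt
  have h' : fderiv ℝ (lieExt F X) (entries g) = _ := h.fderiv
  rw [h']
  simp [add_comm]

/-- The left-invariant field `A ↦ A Y` is linear in `A`; differentiating it along `g X` produces the
first-order term in the direction `g X Y`. -/
theorem apply_lieDeriv_lieDeriv (hF : IsOrbitExt T 2 v F) (hγ : IsOneParam γ X)
    (hη : IsOneParam η Y) (g : SL(2, ℝ)) :
    T g (lieDeriv T γ (lieDeriv T η v)) =
      fderiv ℝ (fderiv ℝ F) (entries g) (mulMat (entries g) X) (mulMat (entries g) Y) +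
        fderiv ℝ F (entries g) (mulMat (mulMat (entries g) X) Y) := by
  have h1 : IsOrbitExt T 1 (lieDeriv T η v) (lieExt F Y) := IsOrbitExt.lie (k := 1) hF hη
  rw [h1.apply_lieDeriv hγ, hF.fderiv_lieExt]

theorem symm (hF : IsOrbitExt T 2 v F) (g : SL(2, ℝ)) (X Y : Mat2) :
    fderiv ℝ (fderiv ℝ F) (entries g) X Y = fderiv ℝ (fderiv ℝ F) (entries g) Y X :=
  ((hF g).1.isSymmSndFDerivAt (by simp)).eq X Y

/-- Since `V² = Q² = 1` and `W² = -1`, the three first-order corrections add up to three times the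
derivative in the direction `g`. This direction is transverse to `SL(2, ℝ)`, where `F` is arbitrary,
so the term has to cancel in every final formula. -/
theorem apply_casimir (hF : IsOrbitExt T 2 v F) (g : SL(2, ℝ)) :
    T g (casimir T v) = (1 / 4 : ℝ) • (
      fderiv ℝ (fderiv ℝ F) (entries g) (mulMat (entries g) tanV) (mulMat (entries g) tanV) +
      fderiv ℝ (fderiv ℝ F) (entries g) (mulMat (entries g) tanQ) (mulMat (entries g) tanQ) -
      fderiv ℝ (fderiv ℝ F) (entries g) (mulMat (entries g) tanW) (mulMat (entries g) tanW) +
      (3 : ℝ) • fderiv ℝ F (entries g) (entries g)) := by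
  have hV : mulMat (mulMat (entries g) tanV) tanV = entries g := by
    funext i j; fin_cases j <;> simp [mulMat, tanV]
  have hQ : mulMat (mulMat (entries g) tanQ) tanQ = entries g := by
    funext i j; fin_cases j <;> simp [mulMat, tanQ]
  have hW : mulMat (mulMat (entries g) tanW) tanW = -entries g := by
    funext i j; fin_cases j <;> simp [mulMat, tanW]
  rw [casimir, map_smul, map_sub, map_add, hF.apply_lieDeriv_lieDeriv isOneParam_hyp isOneParam_hyp,
    hF.apply_lieDeriv_lieDeriv isOneParam_diag isOneParam_diag,
    hF.apply_lieDeriv_lieDeriv isOneParam_rot isOneParam_rot, hV, hQ, hW, map_neg,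
    show (1 / 4 : ℂ) = ((1 / 4 : ℝ) : ℂ) by norm_num, Complex.coe_smul]
  module

theorem translate (hF : IsOrbitExt T k v F) (g : SL(2, ℝ)) :
    IsOrbitExt T k (T g v) (fun A => F (mulMat A (entries g))) := by
  intro h
  constructor
  · have h1 := (hF (h * g)).1
    rw [entries_mul] at h1
    exact h1.comp (entries h) (mulRightL (entries g)).contDiff.contDiffAt
  · change F (mulMat (entries h) (entries g)) = _
    rw [← entries_mul, (hF (h * g)).2, map_mul]
    rfl

theorem fderiv_fderiv_translate (hF : IsOrbitExt T 2 v F) (g : SL(2, ℝ)) (X Y : Mat2) :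
    fderiv ℝ (fderiv ℝ (fun A => F (mulMat A (entries g)))) (entries 1) X Y =
      fderiv ℝ (fderiv ℝ F) (entries g) (mulMat X (entries g)) (mulMat Y (entries g)) := by
  -- `F` is differentiable only near the group, so the chain rule for `fderiv` holds as an equality
  -- of germs, which is enough to differentiate once more.
  have hev : ∀ᶠ B in nhds (entries g), DifferentiableAt ℝ F B :=
    ((hF g).1.eventually (by simp)).mono fun B hB => hB.differentiableAt (by simp)
  have hcont : Filter.Tendsto (mulRightL (entries g)) (nhds (entries 1)) (nhds (entries g)) := by
    have := (mulRightL (entries g)).continuous.tendsto (entries 1)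
    rwa [mulRightL_apply, one_mulMat] at this
  have heq : fderiv ℝ (fun A => F (mulMat A (entries g))) =ᶠ[nhds (entries 1)]
      fun A => (fderiv ℝ F (mulRightL (entries g) A)).comp (mulRightL (entries g)) := by
    filter_upwards [hcont.eventually hev] with A hA
    exact (hA.hasFDerivAt.comp A (mulRightL (entries g)).hasFDerivAt).fderiv
  rw [heq.fderiv_eq]
  have h1 := hF.hasFDerivAt_fderiv g
  rw [← one_mulMat (entries g), ← mulRightL_apply] at h1
  have h2 := h1.comp (entries 1) (mulRightL (entries g)).hasFDerivAt
  have h3 := h2.clm_comp (hasFDerivAt_const (mulRightL (entries g)) (entries 1))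
  have h4 := h3.fderiv
  simp only [Function.comp_def] at h4
  rw [h4]
  simp [one_mulMat]

theorem fderiv_translate (hF : IsOrbitExt T 1 v F) (g : SL(2, ℝ)) (X : Mat2) :
    fderiv ℝ (fun A => F (mulMat A (entries g))) (entries 1) X =
      fderiv ℝ F (entries g) (mulMat X (entries g)) := by
  have h1 := (hF.differentiableAt g).hasFDerivAt
  rw [← one_mulMat (entries g), ← mulRightL_apply] at h1
  have h2 := (h1.comp (entries 1) (mulRightL (entries g)).hasFDerivAt).fderiv
  simp only [Function.comp_def, mulRightL_apply] at h2
  rw [h2]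
  simp [one_mulMat]

end IsOrbitExt

/-- The tensor `V ⊗ V + Q ⊗ Q - W ⊗ W` is invariant under conjugation. -/
theorem quadratic_casimir_invariant (B : Mat2 →L[ℝ] Mat2 →L[ℝ] H)
    (hB : ∀ X Y, B X Y = B Y X) (g : SL(2, ℝ)) :
    B (mulMat tanV (entries g)) (mulMat tanV (entries g)) +
      B (mulMat tanQ (entries g)) (mulMat tanQ (entries g)) -
      B (mulMat tanW (entries g)) (mulMat tanW (entries g)) =
    B (mulMat (entries g) tanV) (mulMat (entries g) tanV) +
      B (mulMat (entries g) tanQ) (mulMat (entries g) tanQ) -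
      B (mulMat (entries g) tanW) (mulMat (entries g) tanW) := by
  -- The tensor equals `2 ∑ E_ij ⊗ E_ji - 1 ⊗ 1`, and `∑ E_ij ⊗ E_ji` is the swap, which commutes
  -- with `g ⊗ g`; the determinant plays no role. The check is done on the ten coefficients of the
  -- symmetric form `B` in matrix units.
  let e : Fin 2 → Fin 2 → Mat2 := fun i j => Pi.single i (Pi.single j 1)
  have hA : ∀ A : Mat2, A = A 0 0 • e 0 0 + A 0 1 • e 0 1 + A 1 0 • e 1 0 + A 1 1 • e 1 1 := by
    intro A
    funext i j
    fin_cases i <;> fin_cases j <;> simp [e]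
  have hBB : ∀ A C : Mat2, B A C =
      (A 0 0 * C 0 0) • B (e 0 0) (e 0 0) + (A 0 1 * C 0 1) • B (e 0 1) (e 0 1) +
      (A 1 0 * C 1 0) • B (e 1 0) (e 1 0) + (A 1 1 * C 1 1) • B (e 1 1) (e 1 1) +
      (A 0 0 * C 0 1 + A 0 1 * C 0 0) • B (e 0 0) (e 0 1) +
      (A 0 0 * C 1 0 + A 1 0 * C 0 0) • B (e 0 0) (e 1 0) +
      (A 0 0 * C 1 1 + A 1 1 * C 0 0) • B (e 0 0) (e 1 1) +
      (A 0 1 * C 1 0 + A 1 0 * C 0 1) • B (e 0 1) (e 1 0) +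
      (A 0 1 * C 1 1 + A 1 1 * C 0 1) • B (e 0 1) (e 1 1) +
      (A 1 0 * C 1 1 + A 1 1 * C 1 0) • B (e 1 0) (e 1 1) := by
    intro A C
    have hAC : B A C = B (A 0 0 • e 0 0 + A 0 1 • e 0 1 + A 1 0 • e 1 0 + A 1 1 • e 1 1)
        (C 0 0 • e 0 0 + C 0 1 • e 0 1 + C 1 0 • e 1 0 + C 1 1 • e 1 1) := by
      rw [← hA A, ← hA C]
    rw [hAC]
    simp only [map_add, map_smul, add_apply, smul_apply]
    rw [hB (e 0 1) (e 0 0), hB (e 1 0) (e 0 0), hB (e 1 1) (e 0 0), hB (e 1 0) (e 0 1),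
      hB (e 1 1) (e 0 1), hB (e 1 1) (e 1 0)]
    module
  rw [hBB (mulMat tanV _), hBB (mulMat tanQ _), hBB (mulMat tanW _), hBB (mulMat _ tanV),
    hBB (mulMat _ tanQ), hBB (mulMat _ tanW)]
  generalize B (e 0 0) (e 0 0) = x1
  generalize B (e 0 1) (e 0 1) = x2
  generalize B (e 1 0) (e 1 0) = x3
  generalize B (e 1 1) (e 1 1) = x4
  generalize B (e 0 0) (e 0 1) = x5
  generalize B (e 0 0) (e 1 0) = x6
  generalize B (e 0 0) (e 1 1) = x7
  generalize B (e 0 1) (e 1 0) = x8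
  generalize B (e 0 1) (e 1 1) = x9
  generalize B (e 1 0) (e 1 1) = x10
  simp only [mulMat, tanV, tanQ, tanW, Matrix.cons_val_zero, Matrix.cons_val_one]
  module

/-- Both sides are given by `apply_casimir`, for the right-translated extension at `1` and for `F`
at `g`. The second derivatives then occur along `X g` and `g X` respectively, and
`quadratic_casimir_invariant` identifies the two sums. -/
theorem casimir_apply {v : H} (hv : IsCkVector T 2 v) (g : SL(2, ℝ)) :
    casimir T (T g v) = T g (casimir T v) := by
  obtain ⟨F, hF⟩ := (isCkVector_iff 2 v).1 hv
  have h1 := (hF.translate g).apply_casimir 1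
  rw [map_one, LinearIsometryEquiv.coe_one, id_eq] at h1
  rw [h1, hF.apply_casimir g]
  simp only [one_mulMat]
  rw [hF.fderiv_fderiv_translate, hF.fderiv_fderiv_translate, hF.fderiv_fderiv_translate,
    (hF.mono one_le_two).fderiv_translate, one_mulMat,
    quadratic_casimir_invariant _ (hF.symm g) g]

theorem IsCkVector.apply {k : ℕ} {v : H} (hv : IsCkVector T k v) (g : SL(2, ℝ)) :
    IsCkVector T k (T g v) := by
  obtain ⟨F, hF⟩ := (isCkVector_iff k v).1 hv
  exact ⟨_, hF.translate g⟩

theorem IsCkVector.lieDeriv {k : ℕ} {v : H} (hv : IsCkVector T (k + 1) v) {γ : ℝ → SL(2, ℝ)}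
    {X : Mat2} (hγ : IsOneParam γ X) : IsCkVector T k (lieDeriv T γ v) := by
  obtain ⟨F, hF⟩ := (isCkVector_iff _ v).1 hv
  exact ⟨_, hF.lie hγ⟩

theorem IsCkVector.mono {k l : ℕ} {v : H} (hv : IsCkVector T k v) (h : l ≤ k) :
    IsCkVector T l v := by
  obtain ⟨F, hF⟩ := (isCkVector_iff _ v).1 hv
  exact ⟨_, hF.mono h⟩

theorem IsCkVector.smul {k : ℕ} {v : H} (hv : IsCkVector T k v) (c : ℂ) :
    IsCkVector T k (c • v) := by
  obtain ⟨F, hF⟩ := hv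
  refine ⟨fun A => c • F A, fun g => ⟨(hF g).1.const_smul c, ?_⟩⟩
  simp only [(hF g).2, map_smul]

/-! ### Skew-symmetry of Lie derivatives -/

theorem inner_apply_left (g : SL(2, ℝ)) (v w : H) :
    inner ℂ (T g v) w = inner ℂ v (T g⁻¹ w) := by
  have h : T g (T g⁻¹ w) = w := by
    rw [map_inv]
    exact (T g).apply_symm_apply w
  rw [← (T g).inner_map_map v, h]

theorem inner_apply_right (g : SL(2, ℝ)) (v w : H) :
    inner ℂ v (T g w) = inner ℂ (T g⁻¹ v) w := by
  rw [inner_apply_left, inv_inv]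

/-- By unitarity the adjoint of `T (γ t)` is `T (γ (-t))`, and reversing time changes the sign of
the derivative. -/
theorem inner_lieDeriv {v w : H} (hv : IsCkVector T 1 v) (hw : IsCkVector T 1 w)
    {γ : ℝ → SL(2, ℝ)} {X : Mat2} (hγ : IsOneParam γ X) :
    inner ℂ (lieDeriv T γ v) w = -inner ℂ v (lieDeriv T γ w) := by
  obtain ⟨F, hF⟩ := (isCkVector_iff 1 v).1 hv
  obtain ⟨G, hG⟩ := (isCkVector_iff 1 w).1 hw
  have h1 := (hF.hasDerivAt_lieDeriv hγ).inner ℂ (hasDerivAt_const (0 : ℝ) w)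
  have h2 : HasDerivAt (fun s => T (γ s) w) (lieDeriv T γ w) (-0) := by
    rw [neg_zero]; exact hG.hasDerivAt_lieDeriv hγ
  have h3 := (hasDerivAt_const (0 : ℝ) v).inner ℂ (h2.scomp (0 : ℝ) (hasDerivAt_neg (0 : ℝ)))
  simp only [inner_zero_right, inner_zero_left, zero_add, add_zero, neg_smul, one_smul,
    inner_neg_right] at h1 h3
  refine h1.unique (h3.congr_of_eventuallyEq (Filter.Eventually.of_forall fun t => ?_))
  simp [inner_apply_left, hγ.neg]

theorem inner_lieDeriv_lieDeriv {v w : H} (hv : IsCkVector T 2 v) (hw : IsCkVector T 2 w)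
    {γ : ℝ → SL(2, ℝ)} {X : Mat2} (hγ : IsOneParam γ X) :
    inner ℂ (lieDeriv T γ (lieDeriv T γ v)) w = inner ℂ v (lieDeriv T γ (lieDeriv T γ w)) := by
  rw [inner_lieDeriv (hv.lieDeriv hγ) (hw.mono one_le_two) hγ,
    inner_lieDeriv (hv.mono one_le_two) (hw.lieDeriv hγ) hγ, neg_neg]

theorem inner_casimir {v w : H} (hv : IsCkVector T 2 v) (hw : IsCkVector T 2 w) :
    inner ℂ (casimir T v) w = inner ℂ v (casimir T w) := by
  simp only [casimir, inner_smul_left, inner_smul_right, inner_add_left, inner_add_right,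
    inner_sub_left, inner_sub_right, inner_lieDeriv_lieDeriv hv hw isOneParam_rot,
    inner_lieDeriv_lieDeriv hv hw isOneParam_diag, inner_lieDeriv_lieDeriv hv hw isOneParam_hyp,
    map_div₀, map_one, Complex.conj_ofNat]

end Ratner

namespace Ratner

open MeasureTheory

/-! ### Smooth vectors

The group acts on the space of `2 × 2` matrices, which are stored here by columns. -/

/-- The product of the matrix `A` with the matrix whose columns are `Y 0` and `Y 1`. -/
def colMul (A Y : Mat2) : Mat2 := fun j i => A i 0 * Y j 0 + A i 1 * Y j 1

/-- The determinant of the matrix with columns `Y 0` and `Y 1`. -/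
def colDet (Y : Mat2) : ℝ := Y 0 0 * Y 1 1 - Y 0 1 * Y 1 0

/-- The adjugate matrix. -/
def adj (A : Mat2) : Mat2 := ![![A 1 1, -A 0 1], ![-A 1 0, A 0 0]]

theorem det_entries (g : SL(2, ℝ)) : g 0 0 * g 1 1 - g 0 1 * g 1 0 = 1 := by
  have h := g.2
  rwa [Matrix.det_fin_two] at h

theorem colDet_entries (g : SL(2, ℝ)) : colDet (entries g) = 1 := det_entries g

theorem adj_colMul (A Y : Mat2) : colMul A (colMul (adj A) Y) = colDet A • Y := by
  funext j i
  fin_cases i <;> simp [colMul, adj, colDet] <;> ring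

theorem entries_inv (g : SL(2, ℝ)) : entries g⁻¹ = adj (entries g) := by
  funext i j
  fin_cases i <;> fin_cases j <;>
    simp [entries, adj, Matrix.SpecialLinearGroup.coe_inv, Matrix.adjugate_fin_two]

theorem colDet_colMul (A Y : Mat2) : colDet (colMul A Y) = colDet A * colDet Y := by
  simp only [colDet, colMul]
  ring

theorem norm_colMul_le (A Y : Mat2) : ‖colMul A Y‖ ≤ 2 * ‖A‖ * ‖Y‖ := by
  have hA : ∀ i j, |A i j| ≤ ‖A‖ := fun i j => (norm_le_pi_norm (A i) j).trans (norm_le_pi_norm A i)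
  have hY : ∀ i j, |Y i j| ≤ ‖Y‖ := fun i j => (norm_le_pi_norm (Y i) j).trans (norm_le_pi_norm Y i)
  have h0 : 0 ≤ 2 * ‖A‖ * ‖Y‖ := by positivity
  refine (pi_norm_le_iff_of_nonneg h0).2 fun j => (pi_norm_le_iff_of_nonneg h0).2 fun i => ?_
  calc ‖colMul A Y j i‖ ≤ |A i 0 * Y j 0| + |A i 1 * Y j 1| := abs_add_le _ _
    _ = |A i 0| * |Y j 0| + |A i 1| * |Y j 1| := by rw [abs_mul, abs_mul]
    _ ≤ ‖A‖ * ‖Y‖ + ‖A‖ * ‖Y‖ := by gcongr <;> first | exact hA _ _ | exact hY _ _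
    _ = _ := by ring

/-- Left multiplication acts on each column separately by a map of determinant one. Storing matrices
by columns makes it a product map, and lets Lebesgue measure on matrices take the place of Haar
measure on the group. -/
theorem measurePreserving_colMul (g : SL(2, ℝ)) :
    MeasurePreserving (colMul (entries g)) volume volume := by
  have h : MeasurePreserving (Matrix.toLin' g.1) (volume : Measure (Fin 2 → ℝ)) volume := by
    refine ⟨(LinearMap.continuous_of_finiteDimensional _).measurable, ?_⟩
    rw [Real.map_matrix_volume_pi_eq_smul_volume_pi (by rw [g.2]; exact one_ne_zero), g.2]
    simp
  have h2 : colMul (entries g) = fun Y j => Matrix.toLin' g.1 (Y j) := by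
    funext Y j i
    simp [colMul, entries, Matrix.mulVec, dotProduct, Fin.sum_univ_two]
  rw [h2]
  exact volume_preserving_pi (fun _ : Fin 2 => h)

theorem contDiff_colMul_adj {k : WithTop ℕ∞} :
    ContDiff ℝ k fun q : Mat2 × Mat2 => colMul (adj q.1) (-q.2) := by
  have h1 : ∀ i j, ContDiff ℝ k fun q : Mat2 × Mat2 => q.1 i j := fun i j => by fun_prop
  have h2 : ∀ i j, ContDiff ℝ k fun q : Mat2 × Mat2 => q.2 i j := fun i j => by fun_prop
  refine contDiff_pi.2 fun j => contDiff_pi.2 fun i => ?_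
  fin_cases i <;> simp only [colMul, adj] <;> simp <;> fun_prop

theorem continuous_colDet : Continuous colDet := by
  unfold colDet
  fun_prop

variable {H : Type*} [NormedAddCommGroup H] [InnerProductSpace ℂ H]

/-- Integrals `∫ f (adj A * Y) • Ψ Y` depend smoothly on the invertible matrix `A`. -/
theorem contDiffAt_integral_colMul {k : ℕ} {f : Mat2 → ℂ} (hf : ContDiff ℝ k f)
    (hfc : HasCompactSupport f) {Ψ : Mat2 → H} (hΨ : LocallyIntegrable Ψ volume) {A₀ : Mat2}
    (hA₀ : colDet A₀ ≠ 0) :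
    ContDiffAt ℝ k (fun A => ∫ Y, f (colMul (adj A) Y) • Ψ Y) A₀ := by
  obtain ⟨R, hR⟩ := hfc.isCompact.isBounded.exists_norm_le
  have hR' : ∀ Y, f Y ≠ 0 → ‖Y‖ ≤ R := fun Y hY => hR Y (subset_tsupport f hY)
  -- On this neighbourhood of `A₀` the determinant stays away from zero and the norm is bounded, so
  -- all the functions `Y ↦ f (adj A * Y)` are supported in one compact ball, as smooth dependence
  -- on the parameter requires.
  set δ := |colDet A₀| / 2 with hδ
  have hδ0 : 0 < δ := by positivity
  set s : Set Mat2 := {A | δ < |colDet A|} ∩ {A | ‖A‖ < ‖A₀‖ + 1} with hs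
  have hso : IsOpen s := (isOpen_lt continuous_const continuous_colDet.abs).inter
    (isOpen_lt continuous_norm continuous_const)
  have hA₀s : A₀ ∈ s := by
    refine ⟨?_, by simp⟩
    have := abs_pos.2 hA₀
    change |colDet A₀| / 2 < |colDet A₀|
    linarith
  let L : H →L[ℝ] ℂ →L[ℝ] H := (ContinuousLinearMap.lsmul ℝ ℂ).flip
  -- The integral is the convolution of `Ψ` with `Y ↦ f (adj A * (-Y))` evaluated at `0`.
  have key := contDiffOn_convolution_right_with_param (μ := (volume : Measure Mat2)) (f := Ψ)
    (n := k) L (g := fun A Y => f (colMul (adj A) (-Y))) hso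
    (isCompact_closedBall (0 : Mat2) (2 * (‖A₀‖ + 1) * R / δ)) ?_ hΨ ?_
  · have h2 := key.contDiffAt (x := (A₀, 0))
      ((hso.prod isOpen_univ).mem_nhds ⟨hA₀s, Set.mem_univ _⟩)
    have h3 := h2.comp A₀ (f := fun A : Mat2 => (A, (0 : Mat2)))
      (contDiff_id.prodMk contDiff_const).contDiffAt
    refine h3.congr_of_eventuallyEq (Filter.Eventually.of_forall fun A => ?_)
    simp [convolution, L]
  · intro A Y hA hY
    by_contra hne
    refine hY ?_
    have h1 := hR' _ hne
    have h2 := norm_colMul_le A (colMul (adj A) (-Y))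
    rw [adj_colMul, norm_smul, norm_neg, Real.norm_eq_abs] at h2
    rw [mem_closedBall_zero_iff, le_div_iff₀ hδ0]
    have h3 : ‖A‖ ≤ ‖A₀‖ + 1 := hA.2.le
    have h4 : δ ≤ |colDet A| := hA.1.le
    calc ‖Y‖ * δ ≤ |colDet A| * ‖Y‖ := by rw [mul_comm]; gcongr
      _ ≤ 2 * ‖A‖ * ‖colMul (adj A) (-Y)‖ := h2
      _ ≤ 2 * (‖A₀‖ + 1) * R := by gcongr
  · exact (hf.comp contDiff_colMul_adj).contDiffOn

/-- The normalization to determinant one. -/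
noncomputable def normalize (Y : Mat2) : SL(2, ℝ) :=
  if h : 0 < colDet Y then
    ⟨Matrix.of fun i j => Y j i / √(colDet Y), by
      have h1 := Real.sq_sqrt h.le
      have h2 := (Real.sqrt_pos.2 h).ne'
      rw [Matrix.det_fin_two]
      simp only [Matrix.of_apply]
      field_simp
      rw [h1, colDet]
      ring⟩
  else 1

theorem entries_normalize {Y : Mat2} (h : 0 < colDet Y) :
    entries (normalize Y) = fun i j => Y j i / √(colDet Y) :=
  (congrArg entries (dif_pos h)).trans rfl

theorem normalize_colMul (g : SL(2, ℝ)) {Y : Mat2} (h : 0 < colDet Y) :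
    normalize (colMul (entries g) Y) = g * normalize Y := by
  have hd : colDet (colMul (entries g) Y) = colDet Y := by
    rw [colDet_colMul, colDet_entries, one_mul]
  refine entries_injective ?_
  rw [entries_mul, entries_normalize (hd ▸ h), entries_normalize h, hd]
  funext i j
  simp only [mulMat, colMul]
  ring

theorem continuousOn_normalize : ContinuousOn normalize {Y | 0 < colDet Y} := by
  refine Topology.IsInducing.subtypeVal.continuousOn_iff.2 ?_
  have h : ContinuousOn (fun Y : Mat2 => fun i j => Y j i / √(colDet Y)) {Y | 0 < colDet Y} := by
    refine continuousOn_pi.2 fun i => continuousOn_pi.2 fun j => ContinuousOn.div ?_ ?_ ?_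
    · fun_prop
    · exact continuous_colDet.sqrt.continuousOn
    · exact fun Y hY => (Real.sqrt_pos.2 hY).ne'
  exact h.congr fun Y hY => entries_normalize hY

variable {T : SL(2, ℝ) →* (H ≃ₗᵢ[ℂ] H)}

/-- The orbit map of `v`, extended to matrices of positive determinant by normalization. -/
noncomputable def radialOrbit (T : SL(2, ℝ) →* (H ≃ₗᵢ[ℂ] H)) (v : H) (Y : Mat2) : H :=
  {Y | 0 < colDet Y}.indicator (fun Y => T (normalize Y) v) Y

theorem isOpen_colDet_pos : IsOpen {Y : Mat2 | 0 < colDet Y} :=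
  isOpen_lt continuous_const continuous_colDet

theorem radialOrbit_of_pos (v : H) {Y : Mat2} (h : 0 < colDet Y) :
    radialOrbit T v Y = T (normalize Y) v :=
  Set.indicator_of_mem (s := {Y | 0 < colDet Y}) h _

theorem radialOrbit_colMul (v : H) (g : SL(2, ℝ)) (Y : Mat2) :
    radialOrbit T v (colMul (entries g) Y) = T g (radialOrbit T v Y) := by
  have hd : colDet (colMul (entries g) Y) = colDet Y := by
    rw [colDet_colMul, colDet_entries, one_mul]
  by_cases h : 0 < colDet Y
  · rw [radialOrbit_of_pos v h, radialOrbit_of_pos v (hd ▸ h), normalize_colMul g h, map_mul]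
    rfl
  · rw [radialOrbit, radialOrbit, Set.indicator_of_notMem (by simpa [hd] using h),
      Set.indicator_of_notMem (by simpa using h), map_zero]

theorem continuousOn_radialOrbit (hT : IsStronglyContinuous T) (v : H) :
    ContinuousOn (radialOrbit T v) {Y | 0 < colDet Y} :=
  ((hT v).comp_continuousOn continuousOn_normalize).congr fun _ hY => radialOrbit_of_pos v hY

theorem locallyIntegrable_radialOrbit (hT : IsStronglyContinuous T) (v : H) :
    LocallyIntegrable (radialOrbit T v) volume := by
  refine (locallyIntegrable_const ‖v‖).mono ?_ (Filter.Eventually.of_forall fun Y => ?_)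
  · refine (aestronglyMeasurable_indicator_iff isOpen_colDet_pos.measurableSet).2 ?_
    exact ((hT v).comp_continuousOn continuousOn_normalize).aestronglyMeasurable
      isOpen_colDet_pos.measurableSet
  · refine (norm_indicator_le_norm_self _ _).trans ?_
    simp

/-- Equivariance of `radialOrbit` followed by the measure-preserving substitution `Y ↦ g Y` moves
the action of `g` onto the scalar weight `f`, where smoothness in `g` is visible. -/
theorem apply_integral_radialOrbit [CompleteSpace H] (f : Mat2 → ℂ) (v : H) (g : SL(2, ℝ)) :
    T g (∫ Y, f Y • radialOrbit T v Y) =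
      ∫ Y, f (colMul (adj (entries g)) Y) • radialOrbit T v Y := by
  have hinv : ∀ Y, colMul (entries g) (colMul (entries g⁻¹) Y) = Y := fun Y => by
    rw [entries_inv, adj_colMul, colDet_entries, one_smul]
  have hinv' : ∀ Y, colMul (entries g⁻¹) (colMul (entries g) Y) = Y := fun Y => by
    conv_lhs => rw [← inv_inv g, inv_inv g⁻¹]
    rw [entries_inv g⁻¹, adj_colMul, colDet_entries, one_smul]
  have hcont : ∀ h : SL(2, ℝ), Continuous (colMul (entries h)) := fun h => by
    unfold colMul; fun_prop
  let e : Mat2 ≃ₜ Mat2 :=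
    { toFun := colMul (entries g)
      invFun := colMul (entries g⁻¹)
      left_inv := hinv'
      right_inv := hinv
      continuous_toFun := hcont g
      continuous_invFun := hcont g⁻¹ }
  have h1 := (measurePreserving_colMul g).integral_comp e.measurableEmbedding
    (fun Y => f (colMul (adj (entries g)) Y) • radialOrbit T v Y)
  rw [← h1]
  have h2 := (T g).toContinuousLinearEquiv.integral_comp_comm (μ := volume)
    (fun Y => f Y • radialOrbit T v Y)
  refine h2.symm.trans (integral_congr_ae (Filter.Eventually.of_forall fun Y => ?_))
  change T g (f Y • radialOrbit T v Y) = _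
  simp only [map_smul, radialOrbit_colMul, ← entries_inv, hinv']

/-- Gårding vectors are `C^k`. -/
theorem isCkVector_integral_radialOrbit [CompleteSpace H] (hT : IsStronglyContinuous T) {k : ℕ} {f : Mat2 → ℂ}
    (hf : ContDiff ℝ k f) (hfc : HasCompactSupport f) (v : H) :
    IsCkVector T k (∫ Y, f Y • radialOrbit T v Y) :=
  ⟨fun A => ∫ Y, f (colMul (adj A) Y) • radialOrbit T v Y, fun g =>
    ⟨contDiffAt_integral_colMul hf hfc (locallyIntegrable_radialOrbit hT v)
      (by rw [show (fun i j => g i j) = entries g from rfl, colDet_entries]; exact one_ne_zero),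
      (apply_integral_radialOrbit f v g).symm⟩⟩

end Ratner

namespace Ratner

open MeasureTheory

/-! ### Smoothness of vectors in one-dimensional `K`-types -/

/-- The first column of a matrix as a complex number, on which `rot θ` acts by `exp (i θ)`. -/
noncomputable def firstCol (Y : Mat2) : ℂ := Y 0 0 - Complex.I * Y 0 1

/-- A polynomial function on which `rot θ` acts by `exp (-i n θ)`. -/
noncomputable def phase (n : ℤ) (Y : Mat2) : ℂ :=
  if 0 ≤ n then (starRingEnd ℂ (firstCol Y)) ^ n.natAbs else firstCol Y ^ n.natAbs

/-- Coordinates on the quotient of the space of matrices by rotations. -/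
def rotInv (Y : Mat2) : ℝ × ℝ × ℝ :=
  (Y 0 0 ^ 2 + Y 0 1 ^ 2, Y 0 0 * Y 1 0 + Y 0 1 * Y 1 1, colDet Y)

/-- The upper triangular matrix with given `rotInv` coordinates. -/
noncomputable def triang (x : ℝ × ℝ × ℝ) : Mat2 :=
  ![![√x.1, 0], ![x.2.1 / √x.1, x.2.2 / √x.1]]

theorem firstCol_rot (θ : ℝ) (Y : Mat2) :
    firstCol (colMul (entries (rot θ)) Y) = Complex.exp (Complex.I * θ) * firstCol Y := by
  rw [mul_comm Complex.I, Complex.exp_mul_I]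
  simp only [firstCol, colMul, entries_rot, Matrix.cons_val_zero, Matrix.cons_val_one]
  push_cast
  linear_combination (Complex.sin θ * Y 0 1) * Complex.I_sq

theorem conj_exp_I_mul (x : ℝ) :
    starRingEnd ℂ (Complex.exp (Complex.I * x)) = Complex.exp (-(Complex.I * x)) := by
  rw [← Complex.exp_conj, map_mul, Complex.conj_I, Complex.conj_ofReal, neg_mul]

theorem phase_rot (n : ℤ) (θ : ℝ) (Y : Mat2) :
    phase n (colMul (entries (rot θ)) Y) = Complex.exp (-(Complex.I * n * θ)) * phase n Y := by
  unfold phase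
  split_ifs with hn
  · rw [firstCol_rot, map_mul, mul_pow, conj_exp_I_mul, ← Complex.exp_nat_mul]
    have : ((n.natAbs : ℕ) : ℂ) = n := by rw [← Int.cast_natCast, Int.natAbs_of_nonneg hn]
    rw [this]
    ring_nf
  · rw [firstCol_rot, mul_pow, ← Complex.exp_nat_mul]
    have : ((n.natAbs : ℕ) : ℂ) = -n := by
      rw [← Int.cast_natCast, Int.ofNat_natAbs_of_nonpos (not_le.1 hn).le, Int.cast_neg]
    rw [this]
    ring_nf

theorem rotInv_rot (θ : ℝ) (Y : Mat2) : rotInv (colMul (entries (rot θ)) Y) = rotInv Y := by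
  have h := Real.sin_sq_add_cos_sq θ
  refine Prod.ext ?_ (Prod.ext ?_ ?_)
  · simp only [rotInv, colMul, entries_rot, Matrix.cons_val_zero, Matrix.cons_val_one]
    linear_combination (Y 0 0 ^ 2 + Y 0 1 ^ 2) * h
  · simp only [rotInv, colMul, entries_rot, Matrix.cons_val_zero, Matrix.cons_val_one]
    linear_combination (Y 0 0 * Y 1 0 + Y 0 1 * Y 1 1) * h
  · simp only [rotInv, colDet_colMul, colDet_entries, one_mul]

theorem contDiff_phase (n : ℤ) {k : WithTop ℕ∞} : ContDiff ℝ k (phase n) := by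
  have h0 : ∀ i j, ContDiff ℝ k fun Y : Mat2 => (Y i j : ℂ) := fun i j =>
    Complex.ofRealCLM.contDiff.comp (by fun_prop)
  have h1 : ContDiff ℝ k firstCol := (h0 0 0).sub (contDiff_const.mul (h0 0 1))
  unfold phase
  split_ifs
  · exact (Complex.conjCLE.contDiff.comp h1).pow _
  · exact h1.pow _

theorem contDiff_rotInv {k : WithTop ℕ∞} : ContDiff ℝ k rotInv := by
  unfold rotInv colDet
  fun_prop

/-- This is the QR decomposition: the rotation angle is the argument of the first column read as a
complex number. -/
theorem exists_rot_triang {Y : Mat2} (h : 0 < (rotInv Y).1) :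
    ∃ θ : ℝ, Y = colMul (entries (rot θ)) (triang (rotInv Y)) := by
  have hp : 0 < √(rotInv Y).1 := Real.sqrt_pos.2 h
  have hp2 : √(rotInv Y).1 ^ 2 = Y 0 0 ^ 2 + Y 0 1 ^ 2 := Real.sq_sqrt h.le
  set p := √(rotInv Y).1 with hpdef
  have hz : firstCol Y ≠ 0 := fun h0 => by
    have h1 := congrArg Complex.re h0
    have h2 := congrArg Complex.im h0
    simp [firstCol] at h1 h2
    rw [h1, h2] at hp2
    nlinarith
  have hnorm : ‖firstCol Y‖ = p := by
    rw [Complex.norm_def, Complex.normSq_apply, hpdef, rotInv]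
    congr 1
    simp [firstCol]
    ring
  have hc : Real.cos (firstCol Y).arg = Y 0 0 / p := by
    rw [Complex.cos_arg hz, hnorm]
    simp [firstCol]
  have hs : Real.sin (firstCol Y).arg = -Y 0 1 / p := by
    rw [Complex.sin_arg, hnorm]
    simp [firstCol]
  refine ⟨(firstCol Y).arg, ?_⟩
  have hJ1 : (rotInv Y).2.1 = Y 0 0 * Y 1 0 + Y 0 1 * Y 1 1 := rfl
  have hJ2 : (rotInv Y).2.2 = Y 0 0 * Y 1 1 - Y 0 1 * Y 1 0 := rfl
  funext j i
  fin_cases j <;> fin_cases i <;>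
    simp [colMul, entries_rot, hc, hs, triang, ← hpdef, hJ1, hJ2] <;> field_simp
  · linear_combination Y 1 0 * hp2
  · linear_combination Y 1 1 * hp2

theorem triang_base : triang (1, 0, 1) = entries 1 := by
  funext i j
  fin_cases i <;> fin_cases j <;> simp [triang, entries]

theorem continuousAt_triang : ContinuousAt triang (1, 0, 1) := by
  have h1 : ContinuousAt (fun x : ℝ × ℝ × ℝ => √x.1) (1, 0, 1) := by fun_prop
  have h0 : √((1 : ℝ), (0 : ℝ), (1 : ℝ)).1 ≠ 0 := by simp
  refine continuousAt_pi.2 fun i => continuousAt_pi.2 fun j => ?_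
  fin_cases i <;> fin_cases j
  · exact h1
  · exact continuousAt_const
  · exact ContinuousAt.div (by fun_prop) h1 h0
  · exact ContinuousAt.div (by fun_prop) h1 h0

theorem phase_triang (n : ℤ) (x : ℝ × ℝ × ℝ) :
    phase n (triang x) = ((√x.1 ^ n.natAbs : ℝ) : ℂ) := by
  unfold phase
  split_ifs <;> simp [firstCol, triang]

variable {H : Type*} [NormedAddCommGroup H] [InnerProductSpace ℂ H]
  {T : SL(2, ℝ) →* (H ≃ₗᵢ[ℂ] H)}

theorem inner_rot_right {n : ℤ} {v : H} (hv : v ∈ kTypeSpace T n) (θ : ℝ) (w : H) :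
    inner ℂ v (T (rot θ) w) = Complex.exp (Complex.I * n * θ) * inner ℂ v w := by
  have h := hv (-θ)
  rw [inner_apply_right, ← isOneParam_rot.neg, h, inner_smul_left, ← Complex.exp_conj]
  congr 2
  simp

/-- Rotating `Y` multiplies the two factors by opposite phases, so the product depends only on
`rotInv Y` and can be evaluated at the triangular representative. -/
theorem phase_mul_inner {n : ℤ} {v : H} (hv : v ∈ kTypeSpace T n) {Y : Mat2}
    (h : 0 < (rotInv Y).1) (w : H) :
    phase n Y * inner ℂ v (radialOrbit T w Y) =
      ((√(rotInv Y).1 ^ n.natAbs : ℝ) : ℂ) *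
        inner ℂ v (radialOrbit T w (triang (rotInv Y))) := by
  obtain ⟨θ, hθ⟩ := exists_rot_triang h
  have h1 : phase n Y = Complex.exp (-(Complex.I * n * θ)) * phase n (triang (rotInv Y)) := by
    conv_lhs => rw [hθ]
    exact phase_rot n θ _
  have h2 : inner ℂ v (radialOrbit T w Y) =
      Complex.exp (Complex.I * n * θ) * inner ℂ v (radialOrbit T w (triang (rotInv Y))) := by
    conv_lhs => rw [hθ]
    rw [radialOrbit_colMul, inner_rot_right hv]
  have h3 : Complex.exp (-(Complex.I * n * θ)) * Complex.exp (Complex.I * n * θ) = 1 := by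
    rw [← Complex.exp_add, neg_add_cancel, Complex.exp_zero]
  rw [h1, h2, phase_triang]
  linear_combination (((√(rotInv Y).1 ^ n.natAbs : ℝ) : ℂ) *
        inner ℂ v (radialOrbit T w (triang (rotInv Y)))) * h3

/-- At the base point `triang` is the identity matrix and the inner product is `‖v‖² > 0`;
continuity does the rest. -/
theorem eventually_inner_triang_pos (hT : IsStronglyContinuous T) {v : H} (hv : v ≠ 0) :
    ∀ᶠ x in nhds ((1 : ℝ), (0 : ℝ), (1 : ℝ)),
      0 < (inner ℂ v (radialOrbit T v (triang x))).re := by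
  have hpos : 0 < colDet (triang (1, 0, 1)) := by
    rw [triang_base, colDet_entries]; exact one_pos
  have h1 : ContinuousAt (radialOrbit T v) (triang (1, 0, 1)) :=
    (continuousOn_radialOrbit hT v).continuousAt (isOpen_colDet_pos.mem_nhds hpos)
  have h2 : ContinuousAt (fun x => radialOrbit T v (triang x)) (1, 0, 1) :=
    ContinuousAt.comp (f := triang) h1 continuousAt_triang
  have h3 : ContinuousAt (fun x => (inner ℂ v (radialOrbit T v (triang x))).re) (1, 0, 1) :=
    Complex.continuous_re.continuousAt.comp ((innerSL ℂ v).continuous.continuousAt.comp h2)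
  have hn : normalize (triang (1, 0, 1)) = 1 := by
    refine entries_injective ?_
    rw [entries_normalize hpos, triang_base, colDet_entries]
    funext i j
    fin_cases i <;> fin_cases j <;> simp [entries]
  refine h3.eventually (lt_mem_nhds ?_)
  change 0 < (inner ℂ v (radialOrbit T v (triang (1, 0, 1)))).re
  rw [radialOrbit_of_pos v hpos, hn, map_one]
  change 0 < (inner ℂ v v).re
  have h4 := norm_pos_iff.2 hv
  rw [show (inner ℂ v v).re = ‖v‖ ^ 2 from inner_self_eq_norm_sq (𝕜 := ℂ) v]
  positivity

/-- Matrices with `rotInv` coordinates close to those of the identity are bounded. -/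
theorem norm_le_of_rotInv_mem {Y : Mat2}
    (h : rotInv Y ∈ Metric.ball ((1 : ℝ), (0 : ℝ), (1 : ℝ)) (1 / 4)) : ‖Y‖ ≤ 2 := by
  rw [Metric.mem_ball, Prod.dist_eq, Prod.dist_eq, max_lt_iff, max_lt_iff, Real.dist_eq,
    Real.dist_eq, Real.dist_eq, abs_lt, abs_lt, abs_lt] at h
  obtain ⟨⟨h1, h2⟩, ⟨h3, h4⟩, h5, h6⟩ := h
  simp only [rotInv] at h1 h2 h3 h4 h5 h6
  -- Lagrange's identity recovers the length of the second column from the `rotInv` coordinates.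
  have hid : (Y 0 0 ^ 2 + Y 0 1 ^ 2) * (Y 1 0 ^ 2 + Y 1 1 ^ 2) =
      (Y 0 0 * Y 1 0 + Y 0 1 * Y 1 1) ^ 2 + colDet Y ^ 2 := by
    rw [colDet]; ring
  have hb : Y 1 0 ^ 2 + Y 1 1 ^ 2 ≤ 4 := by nlinarith [sq_nonneg (Y 1 0), sq_nonneg (Y 1 1)]
  refine (pi_norm_le_iff_of_nonneg zero_le_two).2 fun i =>
    (pi_norm_le_iff_of_nonneg zero_le_two).2 fun j => ?_
  rw [Real.norm_eq_abs]
  refine abs_le_of_sq_le_sq (b := (2 : ℝ)) ?_ (by norm_num)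
  fin_cases i <;> fin_cases j <;> simp <;>
    nlinarith [sq_nonneg (Y 1 0), sq_nonneg (Y 1 1), sq_nonneg (Y 0 0), sq_nonneg (Y 0 1)]

/-- If `v` is a non-zero vector of a `K`-type, then some `C^k` vector of the same `K`-type is not
orthogonal to it. -/
theorem exists_isCkVector_inner_ne_zero [CompleteSpace H] (hT : IsStronglyContinuous T) (k : ℕ)
    {n : ℤ} {v : H} (hv : v ∈ kTypeSpace T n) (hv0 : v ≠ 0) :
    ∃ w ∈ kTypeSpace T n, IsCkVector T k w ∧ inner ℂ v w ≠ 0 := by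
  obtain ⟨ε, hε, hball⟩ := Metric.eventually_nhds_iff_ball.1 (eventually_inner_triang_pos hT hv0)
  -- Radius `ε` gives positivity of the inner product; radius `1/4` keeps the matrices bounded, so
  -- that `f` has compact support, and the first coordinate positive.
  let β : ContDiffBump ((1 : ℝ), (0 : ℝ), (1 : ℝ)) :=
    { rIn := min ε (1 / 4) / 2
      rOut := min ε (1 / 4)
      rIn_pos := by positivity
      rIn_lt_rOut := half_lt_self (by positivity) }
  -- The bump is rotation invariant and `phase n` has weight `-n`, so averaging against `f` lands in
  -- `H_n`.
  let f : Mat2 → ℂ := fun Y => (β (rotInv Y) : ℂ) * phase n Y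
  have hf : ∀ {l : ℕ}, ContDiff ℝ l f := fun {l} =>
    (Complex.ofRealCLM.contDiff.comp ((β.contDiff (n := (l : ℕ∞))).comp contDiff_rotInv)).mul
      (contDiff_phase n)
  have hβ : ∀ Y, β (rotInv Y) ≠ 0 → rotInv Y ∈ Metric.ball ((1 : ℝ), (0 : ℝ), (1 : ℝ)) ε ∧
      rotInv Y ∈ Metric.ball ((1 : ℝ), (0 : ℝ), (1 : ℝ)) (1 / 4) := fun Y hY => by
    have h1 : rotInv Y ∈ Function.support β := hY
    rw [β.support_eq] at h1
    exact ⟨Metric.ball_subset_ball (min_le_left _ _) h1,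
      Metric.ball_subset_ball (min_le_right _ _) h1⟩
  have hfc : HasCompactSupport f := by
    refine HasCompactSupport.of_support_subset_isCompact (isCompact_closedBall (0 : Mat2) 2)
      fun Y hY => ?_
    have h1 : β (rotInv Y) ≠ 0 := fun h0 => hY (by simp [f, h0])
    exact mem_closedBall_zero_iff.2 (norm_le_of_rotInv_mem (hβ Y h1).2)
  have hpos1 : ∀ Y, β (rotInv Y) ≠ 0 → 0 < (rotInv Y).1 := fun Y hY => by
    have h := (hβ Y hY).2
    rw [Metric.mem_ball, Prod.dist_eq, max_lt_iff, Real.dist_eq, abs_lt] at h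
    have := h.1.1
    simp only at this
    linarith
  have hint : Integrable (fun Y => f Y • radialOrbit T v Y) volume :=
    (locallyIntegrable_radialOrbit hT v).integrable_smul_left_of_hasCompactSupport
      (hf (l := 0)).continuous hfc
  refine ⟨∫ Y, f Y • radialOrbit T v Y, fun θ => ?_,
    isCkVector_integral_radialOrbit hT hf hfc v, ?_⟩
  · rw [apply_integral_radialOrbit, ← integral_smul]
    refine integral_congr_ae (Filter.Eventually.of_forall fun Y => ?_)
    have h1 : f (colMul (adj (entries (rot θ))) Y) =
        Complex.exp (Complex.I * n * θ) * f Y := by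
      rw [← entries_inv, ← isOneParam_rot.neg]
      simp only [f, rotInv_rot, phase_rot]
      push_cast
      rw [mul_neg, neg_neg]
      ring
    simp only [h1, mul_smul]
  -- By `phase_mul_inner`, `w` is the real part of the integrand of `⟨v, ∫ f • radialOrbit⟩`. It is
  -- non-negative, and positive on a non-empty open set, so the integral cannot vanish.
  · let w : Mat2 → ℝ := fun Y => β (rotInv Y) * (√(rotInv Y).1 ^ n.natAbs *
      (inner ℂ v (radialOrbit T v (triang (rotInv Y)))).re)
    have hw : ∀ Y, (inner ℂ v (f Y • radialOrbit T v Y)).re = w Y := fun Y => by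
      by_cases h0 : β (rotInv Y) = 0
      · simp [f, w, h0]
      · rw [inner_smul_right]
        simp only [f, w]
        rw [mul_assoc, phase_mul_inner hv (hpos1 Y h0), Complex.re_ofReal_mul,
          Complex.re_ofReal_mul]
    have hw0 : ∀ Y, β (rotInv Y) ≠ 0 → 0 < w Y := fun Y hY => by
      have h1 : 0 < β (rotInv Y) := lt_of_le_of_ne β.nonneg (Ne.symm hY)
      have h2 := hball _ (hβ Y hY).1
      have h3 := Real.sqrt_pos.2 (hpos1 Y hY)
      positivity
    have hwi : Integrable w volume := by
      have h1 : Integrable (fun Y => (inner ℂ v (f Y • radialOrbit T v Y)).re) volume :=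
        (hint.const_inner (𝕜 := ℂ) v).re
      simpa only [hw] using h1
    have hre : (inner ℂ v (∫ Y, f Y • radialOrbit T v Y)).re = ∫ Y, w Y := by
      rw [← integral_inner hint v]
      have h1 := integral_re (𝕜 := ℂ) (hint.const_inner (𝕜 := ℂ) v)
      simp only [RCLike.re_eq_complex_re, hw] at h1
      exact h1.symm
    have hwpos : 0 < ∫ Y, w Y := by
      refine (integral_pos_iff_support_of_nonneg (fun Y => ?_) hwi).2 ?_
      · by_cases h0 : β (rotInv Y) = 0
        · simp [w, h0]
        · exact (hw0 Y h0).le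
      · have ho : IsOpen {Y : Mat2 | β (rotInv Y) ≠ 0} :=
          isOpen_ne_fun (β.continuous.comp (contDiff_rotInv (k := 0)).continuous) continuous_const
        refine (ho.measure_pos volume ⟨entries 1, ?_⟩).trans_le
          (measure_mono fun Y hY => (hw0 Y hY).ne')
        have h1 : rotInv (entries 1) = (1, 0, 1) := by
          simp [rotInv, colDet_entries]
          simp [entries]
        change β (rotInv (entries 1)) ≠ 0
        rw [h1]
        exact (β.pos_of_mem_ball (Metric.mem_ball_self β.rOut_pos)).ne'
    intro h0
    rw [h0, Complex.zero_re] at hre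
    exact hwpos.ne hre

theorem isCkVector_of_finrank_eq_one [CompleteSpace H] (hT : IsStronglyContinuous T) (k : ℕ)
    {n : ℤ} (hn : Module.finrank ℂ (kTypeSpace T n) = 1) {v : H} (hv : v ∈ kTypeSpace T n) :
    IsCkVector T k v := by
  by_cases hv0 : v = 0
  · subst hv0
    exact ⟨fun _ => 0, fun g => ⟨contDiffAt_const, by simp⟩⟩
  obtain ⟨w, hw, hwk, hne⟩ := exists_isCkVector_inner_ne_zero hT k hv hv0
  have hw0 : (⟨w, hw⟩ : kTypeSpace T n) ≠ 0 := fun h => hne (by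
    rw [show w = 0 from congrArg Subtype.val h, inner_zero_right])
  obtain ⟨c, hc⟩ := (finrank_eq_one_iff_of_nonzero' _ hw0).1 hn ⟨v, hv⟩
  rw [← show c • w = v from congrArg Subtype.val hc]
  exact hwk.smul c

end Ratner

namespace Ratner

/-! ### The Casimir parameter -/

variable {H : Type*} [NormedAddCommGroup H] [InnerProductSpace ℂ H]
  {T : SL(2, ℝ) →* (H ≃ₗᵢ[ℂ] H)}

/-- In an irreducible representation a vector orthogonal to the orbit of a non-zero vector
vanishes. -/
theorem eq_zero_of_inner_orbit_eq_zero (hirr : IsIrreducible T) {u : H} (hu : u ≠ 0) {w : H}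
    (hw : ∀ g, inner ℂ (T g u) w = 0) : w = 0 := by
  let S : Submodule ℂ H := ⨅ g : SL(2, ℝ), (innerSL ℂ (T g u)).toLinearMap.ker
  have hS : ∀ x, x ∈ S ↔ ∀ g, inner ℂ (T g u) x = 0 := fun x => by
    simp [S, Submodule.mem_iInf, LinearMap.mem_ker]
  have hclosed : IsClosed (S : Set H) := by
    have : (S : Set H) = ⋂ g : SL(2, ℝ), {x | inner ℂ (T g u) x = 0} := by
      ext x
      simp [hS]
    rw [this]
    exact isClosed_iInter fun g => isClosed_eq (by fun_prop) continuous_const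
  have hinv : ∀ g : SL(2, ℝ), ∀ v ∈ S, T g v ∈ S := fun g v hv => by
    rw [hS] at hv ⊢
    intro h
    rw [inner_apply_right, ← hv (g⁻¹ * h), map_mul]
    rfl
  rcases hirr.2 S hclosed hinv with h | h
  · have h1 : w ∈ S := (hS w).2 hw
    rw [h] at h1
    simpa using h1
  · have h1 : u ∈ S := h ▸ Submodule.mem_top
    have h2 := (hS u).1 h1 1
    rw [map_one] at h2
    exact absurd (inner_self_eq_zero.1 h2) hu

theorem lieDeriv_smul {v : H} (hv : IsCkVector T 1 v) {γ : ℝ → SL(2, ℝ)} {X : Mat2}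
    (hγ : IsOneParam γ X) (c : ℂ) : lieDeriv T γ (c • v) = c • lieDeriv T γ v := by
  obtain ⟨F, hF⟩ := (isCkVector_iff 1 v).1 hv
  have h := (hF.hasDerivAt_lieDeriv hγ).const_smul c
  have h2 : HasDerivAt (fun s => T (γ s) (c • v)) (c • lieDeriv T γ v) 0 := by
    simp only [map_smul]
    exact h
  exact h2.deriv

theorem casimir_smul {v : H} (hv : IsCkVector T 2 v) (c : ℂ) :
    casimir T (c • v) = c • casimir T v := by
  have h1 := hv.mono one_le_two
  have hW : IsCkVector T 1 (lieDeriv T rot v) := hv.lieDeriv (k := 1) isOneParam_rot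
  have hQ : IsCkVector T 1 (lieDeriv T diag v) := hv.lieDeriv (k := 1) isOneParam_diag
  have hV : IsCkVector T 1 (lieDeriv T hyp v) := hv.lieDeriv (k := 1) isOneParam_hyp
  simp only [casimir, lieDeriv_smul h1 isOneParam_rot, lieDeriv_smul h1 isOneParam_diag,
    lieDeriv_smul h1 isOneParam_hyp, lieDeriv_smul hW isOneParam_rot,
    lieDeriv_smul hQ isOneParam_diag, lieDeriv_smul hV isOneParam_hyp]
  module

theorem casimir_mem_kTypeSpace {n : ℤ} {v : H} (hv : v ∈ kTypeSpace T n)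
    (hv2 : IsCkVector T 2 v) : casimir T v ∈ kTypeSpace T n := fun θ => by
  rw [← casimir_apply hv2, hv θ, casimir_smul hv2]

theorem exists_ne_zero_of_isKTypeBasis (hirr : IsIrreducible T) {φ : ℤ → H}
    (hφ : IsKTypeBasis T φ) : ∃ n, φ n ≠ 0 := by
  by_contra! h
  have h1 := hφ.total
  have h2 : Submodule.span ℂ (Set.range φ) = ⊥ := by
    rw [Submodule.span_eq_bot]
    rintro _ ⟨n, rfl⟩
    exact h n
  have h3 : IsClosed ((⊥ : Submodule ℂ H) : Set H) := by simp
  rw [h2, h3.submodule_topologicalClosure_eq] at h1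
  have := hirr.1
  exact bot_ne_top h1

variable {φ : ℤ → H}

theorem isCkVector_of_isKTypeBasis [CompleteSpace H] (hT : IsStronglyContinuous T)
    (hφ : IsKTypeBasis T φ) (k : ℕ) (n : ℤ) : IsCkVector T k (φ n) := by
  by_cases h : φ n = 0
  · rw [h]
    exact ⟨fun _ => 0, fun g => ⟨contDiffAt_const, by simp⟩⟩
  · exact isCkVector_of_finrank_eq_one hT k ((hφ.ne_zero_iff n).1 h) (hφ.mem n)

theorem norm_eq_one_of_isKTypeBasis (hφ : IsKTypeBasis T φ) {n : ℤ} (h : φ n ≠ 0) :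
    ‖φ n‖ = 1 := hφ.orthonormal.1 ⟨n, h⟩

theorem norm_le_one_of_isKTypeBasis (hφ : IsKTypeBasis T φ) (n : ℤ) : ‖φ n‖ ≤ 1 := by
  by_cases h : φ n = 0
  · simp [h]
  · exact (norm_eq_one_of_isKTypeBasis hφ h).le

/-- The Casimir operator preserves the line `H_n`, so `φ n` is an eigenvector, and symmetry makes
the eigenvalue real. For another `C²`-vector `v`, symmetry moves the operator onto the orbit of `φ
n`, so `Ω v - c v` is orthogonal to that orbit; no form of Schur's lemma for unbounded operators is
needed. -/
theorem exists_isCasimirParameter [CompleteSpace H] (hT : IsStronglyContinuous T)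
    (hirr : IsIrreducible T) (hφ : IsKTypeBasis T φ) : ∃ lam : ℝ, IsCasimirParameter T lam := by
  obtain ⟨n, hn⟩ := exists_ne_zero_of_isKTypeBasis hirr hφ
  have hC : IsCkVector T 2 (φ n) := isCkVector_of_isKTypeBasis hT hφ 2 n
  have hne : (⟨φ n, hφ.mem n⟩ : kTypeSpace T n) ≠ 0 := fun h => hn (congrArg Subtype.val h)
  obtain ⟨c, hc⟩ := (finrank_eq_one_iff_of_nonzero' _ hne).1 ((hφ.ne_zero_iff n).1 hn)
    ⟨casimir T (φ n), casimir_mem_kTypeSpace (hφ.mem n) hC⟩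
  have hc' : casimir T (φ n) = c • φ n := (congrArg Subtype.val hc).symm
  have hreal : starRingEnd ℂ c = c := by
    have h := inner_casimir hC hC
    rw [hc', inner_smul_left, inner_smul_right] at h
    exact mul_right_cancel₀ (inner_self_ne_zero.2 hn) h
  refine ⟨c.re, fun v hv => ?_⟩
  rw [Complex.conj_eq_iff_re.1 hreal, ← sub_eq_zero]
  refine eq_zero_of_inner_orbit_eq_zero hirr hn fun g => ?_
  rw [inner_sub_right, ← inner_casimir (hC.apply g) hv, casimir_apply hC, hc', map_smul,
    inner_smul_left, inner_smul_right, hreal, sub_self]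

theorem existsUnique_isCasimirParameter [CompleteSpace H] (hT : IsStronglyContinuous T)
    (hirr : IsIrreducible T) (hφ : IsKTypeBasis T φ) :
    ∃! lam : ℝ, IsCasimirParameter T lam := by
  obtain ⟨lam, hlam⟩ := exists_isCasimirParameter hT hirr hφ
  refine ⟨lam, hlam, fun mu hmu => ?_⟩
  obtain ⟨n, hn⟩ := exists_ne_zero_of_isKTypeBasis hirr hφ
  have hC : IsCkVector T 2 (φ n) := isCkVector_of_isKTypeBasis hT hφ 2 n
  have h := (hmu _ hC).symm.trans (hlam _ hC)
  exact_mod_cast smul_left_injective ℂ hn h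

theorem lieDeriv_rot {n : ℤ} {v : H} (hv : v ∈ kTypeSpace T n) :
    lieDeriv T rot v = (Complex.I * n) • v := by
  have h1 : HasDerivAt (fun θ : ℝ => Complex.exp (Complex.I * n * θ)) (Complex.I * n) 0 := by
    have h2 := ((Complex.ofRealCLM.hasDerivAt (x := (0 : ℝ))).const_mul (Complex.I * n)).cexp
    simpa using h2
  have h3 : HasDerivAt (fun θ : ℝ => T (rot θ) v) ((Complex.I * n) • v) 0 := by
    simp only [hv _]
    exact h1.smul_const v
  exact h3.deriv

theorem inner_lieDeriv_sq {v : H} (hv : IsCkVector T 2 v) {γ : ℝ → SL(2, ℝ)} {X : Mat2}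
    (hγ : IsOneParam γ X) :
    inner ℂ v (lieDeriv T γ (lieDeriv T γ v)) = -((‖lieDeriv T γ v‖ ^ 2 : ℝ) : ℂ) := by
  have h := inner_lieDeriv (hv.mono one_le_two) (hv.lieDeriv (k := 1) hγ) hγ
  rw [inner_self_eq_norm_sq_to_K] at h
  rw [← neg_eq_iff_eq_neg.2 h.symm.symm]
  norm_cast

/-- The Casimir parameter controls the first derivative along the diagonal subgroup. -/
theorem norm_lieDeriv_diag_sq_le {lam : ℝ} (hlam : IsCasimirParameter T lam) {n : ℤ} {v : H}
    (hv : v ∈ kTypeSpace T n) (hv2 : IsCkVector T 2 v) :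
    ‖lieDeriv T diag v‖ ^ 2 ≤ ((n : ℝ) ^ 2 - 4 * lam) * ‖v‖ ^ 2 := by
  have h := congrArg (inner ℂ v) (hlam v hv2)
  rw [casimir, inner_smul_right, inner_smul_right, inner_sub_right, inner_add_right,
    inner_lieDeriv_sq hv2 isOneParam_hyp, inner_lieDeriv_sq hv2 isOneParam_diag,
    inner_lieDeriv_sq hv2 isOneParam_rot, lieDeriv_rot hv, norm_smul, norm_mul, Complex.norm_I,
    one_mul, Complex.norm_intCast, mul_pow, sq_abs,
    show inner ℂ v v = ((‖v‖ ^ 2 : ℝ) : ℂ) by rw [inner_self_eq_norm_sq_to_K]; norm_cast] at h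
  -- Pairing the Casimir equation with `v` turns each second derivative into minus a squared norm;
  -- the `V` term is then discarded.
  have h2 : 1 / 4 * (-‖lieDeriv T hyp v‖ ^ 2 + -‖lieDeriv T diag v‖ ^ 2 -
      -((n : ℝ) ^ 2 * ‖v‖ ^ 2)) = lam * ‖v‖ ^ 2 := by
    refine Complex.ofReal_injective ?_
    push_cast at h ⊢
    exact h
  nlinarith [sq_nonneg ‖lieDeriv T hyp v‖]

end Ratner

namespace Ratner

/-! ### The differential equation of matrix coefficients -/

variable {H : Type*} [NormedAddCommGroup H] [InnerProductSpace ℂ H]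
  {T : SL(2, ℝ) →* (H ≃ₗᵢ[ℂ] H)}

theorem IsCkVector.hasDerivAt_inner_diag {v : H} (hv : IsCkVector T 1 v) (w : H) (t : ℝ) :
    HasDerivAt (fun t => inner ℂ w (T (diag t) v)) (inner ℂ w (T (diag t) (Ratner.lieDeriv T diag v)))
      t := by
  obtain ⟨F, hF⟩ := (isCkVector_iff 1 v).1 hv
  have h := hF.hasDerivAt_orbit isOneParam_diag 1 t
  simp only [one_mul] at h
  have h2 := (hasDerivAt_const t w).inner ℂ h
  simpa using h2

namespace IsOrbitExt

variable {v : H} {F : Mat2 → H}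

theorem hasDerivAt_fderiv (hF : IsOrbitExt T 2 v F) {c : ℝ → SL(2, ℝ)} {Z : Mat2} {s : ℝ}
    (hc : HasDerivAt (fun s => entries (c s)) Z s) (L : Mat2 →L[ℝ] Mat2) :
    HasDerivAt (fun s => fderiv ℝ F (entries (c s)) (L (entries (c s))))
      (fderiv ℝ (fderiv ℝ F) (entries (c s)) Z (L (entries (c s))) +
        fderiv ℝ F (entries (c s)) (L Z)) s := by
  have h1 := (hF.hasFDerivAt_fderiv (c s)).comp_hasDerivAt s hc
  exact h1.clm_apply (L.hasFDerivAt.comp_hasDerivAt s hc)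

theorem inner_fderiv_rot (hF : IsOrbitExt T 1 v F) {n : ℤ} {w : H} (hw : w ∈ kTypeSpace T n)
    (g : SL(2, ℝ)) :
    inner ℂ w (fderiv ℝ F (entries g) (mulMat tanW (entries g))) =
      Complex.I * n * inner ℂ w (T g v) := by
  have h1 := hF.hasDerivAt (isOneParam_rot.hasDerivAt_mul_right g)
  rw [isOneParam_rot.zero, one_mul] at h1
  have h2 := (hasDerivAt_const (0 : ℝ) w).inner ℂ h1
  have h3 : HasDerivAt (fun θ : ℝ => Complex.exp (Complex.I * n * θ) * inner ℂ w (T g v))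
      (Complex.I * n * inner ℂ w (T g v)) 0 := by
    have h4 := ((Complex.ofRealCLM.hasDerivAt (x := (0 : ℝ))).const_mul (Complex.I * n)).cexp
    simpa using h4.mul_const (inner ℂ w (T g v))
  simp only [map_mul] at h2
  have h5 : (fun θ : ℝ => inner ℂ w ((T (rot θ) * T g) v)) =
      fun θ : ℝ => Complex.exp (Complex.I * n * θ) * inner ℂ w (T g v) := by
    funext θ
    exact inner_rot_right hw θ _
  rw [h5] at h2
  simpa using h2.unique h3

end IsOrbitExt

/-- Radial part of the Casimir operator: in `K A K` coordinates the directions `A W` and `W A` are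
governed by the `K`-types of `v` and `w`, leaving only derivatives along `Q`. -/
theorem ode_of_isCasimirParameter {lam : ℝ} (hlam : IsCasimirParameter T lam) {n m : ℤ} {v w : H}
    (hv : v ∈ kTypeSpace T m) (hv2 : IsCkVector T 2 v) (hw : w ∈ kTypeSpace T n) {t : ℝ}
    (ht : t ≠ 0) :
    inner ℂ w (T (diag t) (lieDeriv T diag (lieDeriv T diag v))) =
      (4 * lam + ((n ^ 2 + m ^ 2 - 2 * m * n * Real.cosh (2 * t)) / Real.sinh (2 * t) ^ 2 : ℝ)) *
        inner ℂ w (T (diag t) v) -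
      (2 * (Real.cosh (2 * t) / Real.sinh (2 * t)) : ℝ) *
        inner ℂ w (T (diag t) (lieDeriv T diag v)) := by
  obtain ⟨F, hF⟩ := (isCkVector_iff 2 v).1 hv2
  have hF1 := hF.mono one_le_two
  have hs : Real.sinh (2 * t) ≠ 0 := by simpa using ht
  have hcs := Real.cosh_sq_sub_sinh_sq (2 * t)
  have hc1 : Real.cosh (2 * t) = (Real.exp t ^ 2 + Real.exp (-t) ^ 2) / 2 := by
    rw [Real.cosh_eq, ← Real.exp_nat_mul, ← Real.exp_nat_mul]; push_cast; ring_nf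
  have hs1 : Real.sinh (2 * t) = (Real.exp t ^ 2 - Real.exp (-t) ^ 2) / 2 := by
    rw [Real.sinh_eq, ← Real.exp_nat_mul, ← Real.exp_nat_mul]; push_cast; ring_nf
  have hee : Real.exp t * Real.exp (-t) = 1 := by rw [← Real.exp_add]; simp
  set g := diag t with hg
  set A := entries g with hA
  set D2 := fderiv ℝ (fderiv ℝ F) A with hD2
  set D1 := fderiv ℝ F A with hD1
  set c := Real.cosh (2 * t) with hc
  set s := Real.sinh (2 * t) with hsdef
  have hWWA : mulMat tanW (mulMat tanW A) = -A := by
    funext i j; fin_cases i <;> simp [mulMat, tanW]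
  have hAWW : mulMat (mulMat A tanW) tanW = -A := by
    funext i j; fin_cases j <;> simp [mulMat, tanW]
  have hAQQ : mulMat (mulMat A tanQ) tanQ = A := by
    funext i j; fin_cases j <;> simp [mulMat, tanQ]
  -- At a diagonal matrix with `t ≠ 0`, the direction `A V` is a combination of the right and left
  -- rotation directions; dividing by `sinh 2t` creates the singular coefficients.
  have hAV : mulMat A tanV = (c / s) • mulMat A tanW + (-1 / s) • mulMat tanW A := by
    funext i j
    rw [hA, hg, entries_diag]
    fin_cases i <;> fin_cases j <;> simp [mulMat, tanW, tanV] <;> field_simp <;>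
      rw [hc1, hs1]
    · linear_combination (-Real.exp (-t)) * hee
    · linear_combination Real.exp t * hee
  have hWAW : mulMat (mulMat tanW A) tanW = (-c) • A + s • mulMat A tanQ := by
    funext i j
    rw [hA, hg, entries_diag, hc1, hs1]
    fin_cases i <;> fin_cases j <;> simp [mulMat, tanW, tanQ]
    · linear_combination Real.exp (-t) * hee
    · linear_combination Real.exp t * hee
  have hLW : lieDeriv T rot v = (Complex.I * m) • v := lieDeriv_rot hv
  have hcurve := isOneParam_rot.hasDerivAt_mul_right g
  have r0 := congrArg (inner ℂ w) (hF.apply_casimir g)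
  rw [hlam v hv2, map_smul, inner_smul_right, ← Complex.coe_smul, inner_smul_right, inner_add_right,
    inner_sub_right, inner_add_right, ← Complex.coe_smul 3, inner_smul_right] at r0
  have r1 : inner ℂ w (D2 (mulMat A tanW) (mulMat A tanW)) =
      inner ℂ w (D1 A) - (m : ℂ) ^ 2 * inner ℂ w (T g v) := by
    have h := congrArg (inner ℂ w)
      (hF.apply_lieDeriv_lieDeriv isOneParam_rot isOneParam_rot g)
    rw [hLW, lieDeriv_smul (hv2.mono one_le_two) isOneParam_rot, hLW, map_smul, map_smul,
      inner_smul_right, inner_smul_right, hAWW, inner_add_right, map_neg, inner_neg_right] at h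
    linear_combination -h + (m : ℂ) ^ 2 * inner ℂ w (T g v) * Complex.I_sq
  have e1 := hF1.inner_fderiv_rot hw g
  have r2 : inner ℂ w (D2 (mulMat tanW A) (mulMat tanW A)) =
      inner ℂ w (D1 A) - (n : ℂ) ^ 2 * inner ℂ w (T g v) := by
    have h1 := (hasDerivAt_const (0 : ℝ) w).inner ℂ (hF.hasDerivAt_fderiv hcurve (mulLeftL tanW))
    have h2 := ((hasDerivAt_const (0 : ℝ) w).inner ℂ (hF1.hasDerivAt hcurve)).const_mul
      (Complex.I * n)
    simp only [mulLeftL_apply, hF1.inner_fderiv_rot hw] at h1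
    have h := h1.unique h2
    rw [isOneParam_rot.zero, one_mul, ← hA, inner_zero_left, inner_zero_left, add_zero, add_zero,
      ← hD1, ← hD2, hWWA, inner_add_right, map_neg, inner_neg_right, e1] at h
    linear_combination h + (n : ℂ) ^ 2 * inner ℂ w (T g v) * Complex.I_sq
  -- Mixed derivative: the identity for right rotations is differentiated along a left rotation. The
  -- correction `W A W` is rewritten by `hWAW`, and this is where the first-order term of the
  -- equation originates.
  have r3 : inner ℂ w (D2 (mulMat tanW A) (mulMat A tanW)) =
      c * inner ℂ w (D1 A) - s * inner ℂ w (D1 (mulMat A tanQ)) -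
        (m : ℂ) * n * inner ℂ w (T g v) := by
    have h1 := (hasDerivAt_const (0 : ℝ) w).inner ℂ (hF.hasDerivAt_fderiv hcurve (mulRightL tanW))
    have h2 := ((hasDerivAt_const (0 : ℝ) w).inner ℂ (hF1.hasDerivAt hcurve)).const_mul
      (Complex.I * m)
    simp only [mulRightL_apply, ← hF1.apply_lieDeriv isOneParam_rot, hLW, map_smul,
      inner_smul_right] at h1
    have h := h1.unique h2
    simp only [inner_zero_left, mul_zero, add_zero] at h
    rw [isOneParam_rot.zero, one_mul, ← hA, ← hD1, ← hD2, hWAW, inner_add_right, map_add, map_smul, map_smul, inner_add_right, e1,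
      ← Complex.coe_smul, ← Complex.coe_smul, inner_smul_right, inner_smul_right] at h
    push_cast at h
    linear_combination h + (m : ℂ) * n * inner ℂ w (T g v) * Complex.I_sq
  have r4 : inner ℂ w (T g (lieDeriv T diag v)) = inner ℂ w (D1 (mulMat A tanQ)) := by
    rw [hF1.apply_lieDeriv isOneParam_diag]
  have r5 : inner ℂ w (T g (lieDeriv T diag (lieDeriv T diag v))) =
      inner ℂ w (D2 (mulMat A tanQ) (mulMat A tanQ)) + inner ℂ w (D1 A) := by
    rw [hF.apply_lieDeriv_lieDeriv isOneParam_diag isOneParam_diag, ← hA, hAQQ, inner_add_right]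
  have r6 : D2 (mulMat A tanV) (mulMat A tanV) =
      ((c / s) ^ 2) • D2 (mulMat A tanW) (mulMat A tanW) +
      (2 * (c / s) * (-1 / s)) • D2 (mulMat tanW A) (mulMat A tanW) +
      ((-1 / s) ^ 2) • D2 (mulMat tanW A) (mulMat tanW A) := by
    rw [hAV]
    simp only [map_add, map_smul, add_apply, smul_apply]
    rw [hF.symm g (mulMat A tanW) (mulMat tanW A)]
    module
  rw [← hA, ← hD1, ← hD2, r6, inner_add_right, inner_add_right, ← Complex.coe_smul,
    ← Complex.coe_smul, ← Complex.coe_smul, inner_smul_right, inner_smul_right, inner_smul_right,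
    r1, r2, r3] at r0
  rw [r5, r4]
  have hsC : (s : ℂ) ≠ 0 := by exact_mod_cast hs
  have hcsC : (c : ℂ) ^ 2 - (s : ℂ) ^ 2 = 1 := by exact_mod_cast hcs
  have hi : (s : ℂ) * (s : ℂ)⁻¹ = 1 := mul_inv_cancel₀ hsC
  push_cast at r0 ⊢
  simp only [div_eq_mul_inv] at r0 ⊢
  -- The transverse derivative `D1 A` drops out because `cosh² - sinh² = 1`.
  linear_combination (-4) * r0 +
    (inner ℂ w (D1 A) + (m : ℂ) ^ 2 * inner ℂ w (T g v)) *
      (((s : ℂ)⁻¹) ^ 2 * hcsC + (s * (s : ℂ)⁻¹ + 1) * hi) -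
    2 * c * (s : ℂ)⁻¹ * inner ℂ w (D1 (mulMat A tanQ)) * hi

end Ratner

namespace Ratner

open Filter Topology

/-! ### Decay of matrix coefficients -/

/-- The upper unipotent subgroup. -/
def upper (x : ℝ) : SL(2, ℝ) := ⟨!![1, x; 0, 1], by simp [Matrix.det_fin_two_of]⟩

/-- The lower unipotent subgroup. -/
def lower (x : ℝ) : SL(2, ℝ) := ⟨!![1, 0; x, 1], by simp [Matrix.det_fin_two_of]⟩

theorem entries_upper (x : ℝ) : entries (upper x) = ![![1, x], ![0, 1]] := rfl

theorem entries_lower (x : ℝ) : entries (lower x) = ![![1, 0], ![x, 1]] := rfl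

theorem entries_one : entries 1 = ![![1, 0], ![0, 1]] := by
  funext i j
  fin_cases i <;> fin_cases j <;> simp [entries]

theorem entries_eq (g : SL(2, ℝ)) : entries g = ![![g 0 0, g 0 1], ![g 1 0, g 1 1]] := by
  funext i j
  fin_cases i <;> fin_cases j <;> rfl

theorem continuous_of_entries {X : Type*} [TopologicalSpace X] {f : X → SL(2, ℝ)}
    (h : Continuous fun x => entries (f x)) : Continuous f :=
  continuous_induced_rng.2 h

theorem continuous_upper : Continuous upper := by
  refine continuous_of_entries (continuous_pi fun i => continuous_pi fun j => ?_)
  fin_cases i <;> fin_cases j <;> simp [entries_upper] <;> fun_prop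

theorem continuous_lower : Continuous lower := by
  refine continuous_of_entries (continuous_pi fun i => continuous_pi fun j => ?_)
  fin_cases i <;> fin_cases j <;> simp [entries_lower] <;> fun_prop

theorem upper_zero : upper 0 = 1 := by
  refine entries_injective ?_
  rw [entries_upper, entries_one]

theorem lower_zero : lower 0 = 1 := by
  refine entries_injective ?_
  rw [entries_lower, entries_one]

theorem upper_mul_diag (x t : ℝ) :
    upper x * diag t = diag t * upper (x * Real.exp (-2 * t)) := by
  refine entries_injective ?_
  have h : Real.exp (-t) = Real.exp t * Real.exp (-2 * t) := by rw [← Real.exp_add]; ring_nf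
  rw [entries_mul, entries_mul]
  funext i j
  fin_cases i <;> fin_cases j <;> simp [entries_upper, entries_diag, mulMat]
  rw [h, neg_mul]
  ring

theorem diag_mul_lower (x t : ℝ) :
    diag t * lower x = lower (x * Real.exp (-2 * t)) * diag t := by
  refine entries_injective ?_
  have h : Real.exp (-t) = Real.exp t * Real.exp (-2 * t) := by rw [← Real.exp_add]; ring_nf
  rw [entries_mul, entries_mul]
  funext i j
  fin_cases i <;> fin_cases j <;> simp [entries_lower, entries_diag, mulMat]
  rw [h, neg_mul]
  ring

/-- As `s → 0` the right side tends to `diag t` while `lower s` tends to `1`. A coefficient at a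
vector fixed by `upper` therefore cannot distinguish `diag t` from the identity. -/
theorem upper_mul_lower_mul_upper {s : ℝ} (hs : s ≠ 0) (t : ℝ) :
    upper ((Real.exp t - 1) / s) * lower s * upper ((Real.exp (-t) - 1) / s) =
      lower (s * Real.exp (-t)) * diag t := by
  refine entries_injective ?_
  have h : Real.exp t * Real.exp (-t) = 1 := by rw [← Real.exp_add]; simp
  rw [entries_mul, entries_mul, entries_mul]
  funext i j
  fin_cases i <;> fin_cases j <;>
    simp [entries_lower, entries_upper, entries_diag, mulMat] <;> field_simp
  · ring
  · linear_combination h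
  · linear_combination -h
  · ring

theorem exists_unipotent_mul (g : SL(2, ℝ)) :
    ∃ x y z w : ℝ, g = upper x * lower y * upper z * lower w := by
  have key : ∀ g : SL(2, ℝ), g 1 0 ≠ 0 → ∃ x y z : ℝ, g = upper x * lower y * upper z := by
    intro g hg
    have hd := det_entries g
    refine ⟨(g 0 0 - 1) / g 1 0, g 1 0, (g 1 1 - 1) / g 1 0, entries_injective ?_⟩
    rw [entries_mul, entries_mul, entries_eq g]
    funext i j
    fin_cases i <;> fin_cases j <;> simp [entries_lower, entries_upper, mulMat] <;>
      field_simp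
    · ring
    · linear_combination -hd
    · ring
  by_cases hg : g 1 0 = 0
  · have hd := det_entries g
    have h1 : (g * lower 1) 1 0 ≠ 0 := by
      have h2 := congrFun (congrFun (entries_mul g (lower 1)) 1) 0
      simp [mulMat, entries_lower] at h2
      simp only [entries] at h2
      rw [h2, hg]
      intro h3
      rw [zero_add] at h3
      rw [hg, h3] at hd
      simp at hd
    obtain ⟨x, y, z, h⟩ := key _ h1
    refine ⟨x, y, z, -1, ?_⟩
    rw [← h, mul_assoc]
    refine entries_injective ?_
    rw [entries_mul, entries_mul, entries_eq g]
    funext i j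
    fin_cases i <;> fin_cases j <;> simp [entries_lower, mulMat]
  · obtain ⟨x, y, z, h⟩ := key g hg
    exact ⟨x, y, z, 0, by rw [← h, lower_zero, mul_one]⟩

variable {H : Type*} [NormedAddCommGroup H] [InnerProductSpace ℂ H]
  {T : SL(2, ℝ) →* (H ≃ₗᵢ[ℂ] H)}

/-- Bounded families in a Hilbert space converge weakly along ultrafilters. -/
theorem exists_weak_limit [CompleteSpace H] {ι : Type*} (U : Ultrafilter ι) {u : ι → H} {C : ℝ}
    (hu : ∀ i, ‖u i‖ ≤ C) :
    ∃ w : H, ∀ x, Tendsto (fun i => inner ℂ x (u i)) U (𝓝 (inner ℂ x w)) := by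
  -- Banach–Alaoglu is applied to the functionals `⟨u i, ·⟩`; conjugation then puts the family in
  -- the second slot.
  let f : ι → WeakDual ℂ H := fun i => StrongDual.toWeakDual (InnerProductSpace.toDual ℂ H (u i))
  have hK := WeakDual.isCompact_closedBall (0 : StrongDual ℂ H) C
  have hmem : ∀ i, f i ∈ WeakDual.toStrongDual ⁻¹' Metric.closedBall (0 : StrongDual ℂ H) C := by
    intro i
    simpa [f] using hu i
  obtain ⟨ℓ, -, hℓ⟩ := hK.ultrafilter_le_nhds (U.map f)
    (le_principal_iff.2 (Filter.mem_map.2 (Filter.univ_mem' hmem)))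
  refine ⟨(InnerProductSpace.toDual ℂ H).symm (WeakDual.toStrongDual ℓ), fun x => ?_⟩
  have h1 : Tendsto (fun i => f i x) U (𝓝 (ℓ x)) :=
    (WeakDual.eval_continuous x).continuousAt.tendsto.comp hℓ
  have h2 := (Complex.continuous_conj.tendsto _).comp h1
  have h3 : (starRingEnd ℂ) (ℓ x) =
      inner ℂ x ((InnerProductSpace.toDual ℂ H).symm (WeakDual.toStrongDual ℓ)) := by
    rw [← inner_conj_symm x, InnerProductSpace.toDual_symm_apply]
    rfl
  rw [← h3]
  refine h2.congr fun i => ?_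
  simp only [Function.comp_apply]
  rw [← inner_conj_symm x]
  rfl

/-- Equality case of Cauchy–Schwarz: expanding `‖T g w - w‖²` gives zero. -/
theorem apply_eq_self_of_inner_eq {g : SL(2, ℝ)} {w : H}
    (h : inner ℂ w (T g w) = inner ℂ w w) : T g w = w := by
  have h1 : inner ℂ (T g w) w = inner ℂ w w := by
    rw [← inner_conj_symm, h, inner_conj_symm]
  rw [← sub_eq_zero, ← inner_self_eq_zero (𝕜 := ℂ), inner_sub_left, inner_sub_right,
    inner_sub_right, (T g).inner_map_map, h, h1]
  ring

theorem apply_mul (g h : SL(2, ℝ)) (v : H) : T (g * h) v = T g (T h v) := by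
  rw [map_mul]
  rfl

/-- A vector fixed by the upper unipotent subgroup is fixed by the whole group. -/
theorem apply_eq_self_of_upper (hT : IsStronglyContinuous T) {w : H}
    (hw : ∀ x, T (upper x) w = w) (g : SL(2, ℝ)) : T g w = w := by
  have hcont : ∀ c : ℝ → SL(2, ℝ), Continuous c → Continuous fun s => inner ℂ w (T (c s) w) :=
    fun c hc => continuous_const.inner ((hT w).comp hc)
  have hone : T 1 w = w := by rw [map_one]; rfl
  have hupl : ∀ x y, inner ℂ w (T (upper x) y) = inner ℂ w y := fun x y => by
    conv_lhs => rw [← hw x]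
    exact (T (upper x)).inner_map_map _ _
  have hdiag : ∀ t, T (diag t) w = w := fun t => by
    refine apply_eq_self_of_inner_eq ?_
    have h1 : Tendsto (fun s => inner ℂ w (T (lower s) w)) (𝓝[≠] 0) (𝓝 (inner ℂ w w)) := by
      have h := (hcont lower continuous_lower).tendsto 0
      rw [lower_zero, hone] at h
      exact h.mono_left nhdsWithin_le_nhds
    have h2 : Tendsto (fun s => inner ℂ w (T (lower (s * Real.exp (-t)) * diag t) w)) (𝓝[≠] 0)
        (𝓝 (inner ℂ w (T (diag t) w))) := by
      have h := (hcont (fun s => lower (s * Real.exp (-t)) * diag t)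
        ((continuous_lower.comp (by fun_prop)).mul continuous_const)).tendsto 0
      rw [zero_mul, lower_zero, one_mul] at h
      exact h.mono_left nhdsWithin_le_nhds
    refine tendsto_nhds_unique (h2.congr' ?_) h1
    filter_upwards [self_mem_nhdsWithin] with s hs
    rw [← upper_mul_lower_mul_upper hs, apply_mul, apply_mul, hw, hupl]
  have hdiagl : ∀ t y, inner ℂ w (T (diag t) y) = inner ℂ w y := fun t y => by
    conv_lhs => rw [← hdiag t]
    exact (T (diag t)).inner_map_map _ _
  -- Conjugation by `diag t` contracts `lower s` to the identity as `t → ∞` without changing the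
  -- coefficient, since `w` is already fixed by `diag t`.
  have hlow : ∀ s, T (lower s) w = w := fun s => by
    refine apply_eq_self_of_inner_eq ?_
    have h1 : ∀ t, inner ℂ w (T (lower s) w) =
        inner ℂ w (T (lower (s * Real.exp (-2 * t))) w) := fun t => by
      rw [← hdiagl t, ← apply_mul, diag_mul_lower, apply_mul, hdiag]
    have h2 : Tendsto (fun t : ℝ => s * Real.exp (-2 * t)) atTop (𝓝 0) := by
      have h3 : Tendsto (fun t : ℝ => -2 * t) atTop atBot :=
        tendsto_id.const_mul_atTop_of_neg (by norm_num)
      simpa using (Real.tendsto_exp_atBot.comp h3).const_mul s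
    have h4 := ((hcont lower continuous_lower).tendsto 0).comp h2
    rw [lower_zero, hone] at h4
    exact tendsto_nhds_unique (tendsto_const_nhds.congr h1) h4
  obtain ⟨x, y, z, u, rfl⟩ := exists_unipotent_mul g
  rw [apply_mul, apply_mul, apply_mul, hlow, hw, hlow, hw]

theorem eq_zero_of_forall_apply_eq_self (hirr : IsIrreducible T)
    (hnontriv : ∃ g : SL(2, ℝ), T g ≠ 1) {w : H} (hw : ∀ g, T g w = w) : w = 0 := by
  by_contra hw0
  let S : Submodule ℂ H :=
    { carrier := {v | ∀ g, T g v = v}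
      add_mem' := fun {a b} ha hb g => by rw [map_add, ha g, hb g]
      zero_mem' := fun g => map_zero _
      smul_mem' := fun c v hv g => by rw [map_smul, hv g] }
  have hclosed : IsClosed (S : Set H) := by
    have : (S : Set H) = ⋂ g : SL(2, ℝ), {v | T g v = v} := by
      ext v
      simp [S]
    rw [this]
    exact isClosed_iInter fun g => isClosed_eq (T g).continuous continuous_id
  rcases hirr.2 S hclosed (fun g v hv => by rw [hv g]; exact hv) with h | h
  · have h1 : w ∈ S := hw
    rw [h] at h1
    exact hw0 (by simpa using h1)
  · obtain ⟨g, hg⟩ := hnontriv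
    refine hg (LinearIsometryEquiv.ext fun v => ?_)
    have h1 : v ∈ S := h ▸ Submodule.mem_top
    exact h1 g

/-- Matrix coefficients of a non-trivial irreducible unitary representation tend to zero along the
diagonal subgroup. -/
theorem tendsto_inner_diag_atTop [CompleteSpace H] (hT : IsStronglyContinuous T)
    (hirr : IsIrreducible T) (hnontriv : ∃ g : SL(2, ℝ), T g ≠ 1) (x v : H) :
    Tendsto (fun t => inner ℂ x (T (diag t) v)) atTop (𝓝 0) := by
  rw [tendsto_iff_ultrafilter]
  intro U hU
  obtain ⟨w, hw⟩ := exists_weak_limit U (u := fun t => T (diag t) v) (C := ‖v‖)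
    (fun t => by simp)
  -- Moving `upper s` past `diag t` replaces `s` by `s e^{-2t}`, which tends to `0`; so every weak
  -- limit is fixed by the upper unipotent subgroup, hence by the whole group, hence zero.
  have hwup : ∀ s, T (upper s) w = w := fun s => by
    refine ext_inner_left ℂ fun y => ?_
    have h1 := hw (T (upper s)⁻¹ y)
    rw [← inner_apply_right] at h1
    have h2 : Tendsto (fun t => inner ℂ y (T (diag t) (T (upper (s * Real.exp (-2 * t))) v - v)))
        atTop (𝓝 0) := by
      have h3 : Tendsto (fun t : ℝ => -2 * t) atTop atBot :=
        tendsto_id.const_mul_atTop_of_neg (by norm_num)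
      have h4 : Tendsto (fun t : ℝ => s * Real.exp (-2 * t)) atTop (𝓝 0) := by
        simpa using (Real.tendsto_exp_atBot.comp h3).const_mul s
      have h5 := (((hT v).comp continuous_upper).tendsto 0).comp h4
      have h6 := ((h5.sub_const v).norm).const_mul ‖y‖
      simp only [Function.comp_apply, upper_zero, map_one, LinearIsometryEquiv.coe_one, id_eq,
        sub_self, norm_zero, mul_zero] at h6
      refine squeeze_zero_norm (fun t => ?_) h6
      refine (norm_inner_le_norm _ _).trans ?_
      rw [LinearIsometryEquiv.norm_map]
    have h7 := (hw y).add (h2.mono_left hU)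
    rw [add_zero] at h7
    refine tendsto_nhds_unique (h1.congr fun t => ?_) h7
    rw [← inner_apply_right, ← apply_mul, upper_mul_diag, apply_mul, map_sub, inner_sub_right]
    ring
  have hw0 := eq_zero_of_forall_apply_eq_self hirr hnontriv
    (apply_eq_self_of_upper hT hwup)
  have h := hw x
  rwa [hw0, inner_zero_right] at h

end Ratner

namespace Ratner

open Filter Topology

/-! ### Second order differential equations -/

theorem norm_sub_le_of_hasDerivAt_le {f f' : ℝ → ℂ} {B B' : ℝ → ℝ} {a b : ℝ} (hab : a ≤ b)
    (hf : ∀ x ∈ Set.Icc a b, HasDerivAt f (f' x) x) (hB : ∀ x, HasDerivAt B (B' x) x)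
    (hle : ∀ x ∈ Set.Icc a b, ‖f' x‖ ≤ B' x) : ‖f b - f a‖ ≤ B b - B a := by
  refine image_norm_le_of_norm_deriv_right_le_deriv_boundary (f := fun x => f x - f a)
    (f' := f') (B := fun x => B x - B a) (B' := B') (a := a) (b := b) ?_ ?_ ?_ ?_ ?_
    (Set.right_mem_Icc.2 hab)
  · exact fun x hx => ((hf x hx).sub_const _).continuousAt.continuousWithinAt
  · exact fun x hx => ((hf x (Set.Ico_subset_Icc_self hx)).sub_const _).hasDerivWithinAt
  · simp
  · exact fun x => (hB x).sub_const _
  · exact fun x hx => hle x (Set.Ico_subset_Icc_self hx)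

/-- Growth bound for perturbations of `z'' = κ z`, in terms of the solutions `c`, `S` of the
unperturbed equation. -/
theorem norm_le_of_perturbed_ode {z z1 : ℝ → ℂ} {r : ℝ → ℝ} {c S : ℝ → ℝ} {κ A Z μ t α β : ℝ}
    (hμ : 0 ≤ μ) (hA : 0 ≤ A) (ht : 1 ≤ t)
    (hz : ∀ s, 1 ≤ s → HasDerivAt z (z1 s) s)
    (hz1 : ∀ s, 1 ≤ s → HasDerivAt z1 ((κ + r s) • z s) s)
    (hr : ∀ s, 1 ≤ s → ‖r s • z s‖ ≤ A * Real.exp (-s))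
    (hS : ∀ u, HasDerivAt S (c u) u) (hc : ∀ u, HasDerivAt c (κ * S u) u)
    (hS0 : S 0 = 0) (hc0 : c 0 = 1)
    (hcb : ∀ u, 0 ≤ u → |c u| ≤ Real.exp (μ * u))
    (hSb : ∀ u, 0 ≤ u → |S u| ≤ u * Real.exp (μ * u))
    (hz0 : ‖z 1‖ ≤ Z)
    (hz10 : ∀ u, 0 ≤ u → ‖S u • z1 1‖ ≤ Z * ((α * u + β) * Real.exp (μ * u))) :
    ‖z t‖ ≤ Real.exp (μ * (t - 1)) *
      (Z * (1 + α * (t - 1) + β) + (t - 1) * A * Real.exp (-1)) := by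
  -- Variation of constants in derivative form: `g t = z t`, and differentiating in `s` leaves only
  -- the perturbation, multiplied by `S (t - s)`.
  set g : ℝ → ℂ := fun s => c (t - s) • z s + S (t - s) • z1 s with hg
  have hsub : ∀ s, HasDerivAt (fun s => t - s) (-1) s := fun s => by
    simpa using (hasDerivAt_id s).const_sub t
  have hgd : ∀ s ∈ Set.Icc 1 t, HasDerivAt g (S (t - s) • (r s • z s)) s := fun s hs => by
    have h1 := ((hc (t - s)).comp s (hsub s)).fun_smul (hz s hs.1)
    have h2 := ((hS (t - s)).comp s (hsub s)).fun_smul (hz1 s hs.1)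
    refine (h1.add h2).congr_deriv ?_
    simp only [Function.comp_apply]
    module
  set P := (t - 1) * Real.exp (μ * (t - 1)) with hP
  have hbound : ‖g t - g 1‖ ≤ P * A * -Real.exp (-t) - P * A * -Real.exp (-1) := by
    refine norm_sub_le_of_hasDerivAt_le (B := fun s => P * A * -Real.exp (-s))
      (B' := fun s => P * A * Real.exp (-s)) ht hgd ?_ ?_
    · intro s
      have h := ((hasDerivAt_neg s).exp.neg).const_mul (P * A)
      refine h.congr_deriv ?_
      ring
    · intro s hs
      rw [norm_smul, Real.norm_eq_abs]
      have h1 : |S (t - s)| ≤ P := (hSb _ (by linarith [hs.2])).trans (by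
        have h2 : t - s ≤ t - 1 := by linarith [hs.1]
        have h3 : 0 ≤ t - s := by linarith [hs.2]
        rw [hP]
        gcongr)
      have h2 := hr s hs.1
      have h3 : 0 ≤ P := (abs_nonneg _).trans h1
      calc |S (t - s)| * ‖r s • z s‖ ≤ P * (A * Real.exp (-s)) := by gcongr
        _ = _ := by ring
  have hgt : g t = z t := by simp [hg, hS0, hc0]
  have hg1 : ‖g 1‖ ≤ Real.exp (μ * (t - 1)) * Z +
      Z * ((α * (t - 1) + β) * Real.exp (μ * (t - 1))) := by
    refine (norm_add_le _ _).trans (add_le_add ?_ (hz10 _ (by linarith)))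
    rw [norm_smul, Real.norm_eq_abs]
    exact mul_le_mul (hcb _ (by linarith)) hz0 (norm_nonneg _) (Real.exp_pos _).le
  have h4 : ‖g t‖ ≤ ‖g 1‖ + ‖g t - g 1‖ := by
    simpa using norm_add_le (g 1) (g t - g 1)
  have h5 : 0 ≤ P * A * Real.exp (-t) := by
    have : 0 ≤ t - 1 := by linarith
    positivity
  rw [hgt] at h4 hbound
  calc ‖z t‖ ≤ (Real.exp (μ * (t - 1)) * Z +
      Z * ((α * (t - 1) + β) * Real.exp (μ * (t - 1)))) + P * A * Real.exp (-1) := by linarith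
    _ = _ := by rw [hP]; ring

theorem sinh_le_mul_exp (x : ℝ) : Real.sinh x ≤ x * Real.exp x := by
  have h1 := Real.add_one_le_exp (-2 * x)
  have h2 : Real.exp (-x) = Real.exp x * Real.exp (-2 * x) := by rw [← Real.exp_add]; ring_nf
  rw [Real.sinh_eq, h2]
  nlinarith [Real.exp_pos x]

/-- The solutions of `S'' = κ S` used to bound perturbations. -/
theorem exists_fundamental_solution {κ : ℝ} :
    ∃ c S : ℝ → ℝ, (∀ u, HasDerivAt S (c u) u) ∧ (∀ u, HasDerivAt c (κ * S u) u) ∧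
      S 0 = 0 ∧ c 0 = 1 ∧ (∀ u, 0 ≤ u → |c u| ≤ Real.exp (√κ * u)) ∧
      (∀ u, 0 ≤ u → |S u| ≤ u * Real.exp (√κ * u)) ∧
      ∀ u, 0 ≤ u → √(-κ) * |S u| ≤ Real.exp (√κ * u) := by
  -- Oscillating, linear and hyperbolic cases. As the real square root of a negative number is `0`,
  -- the bounds with `√κ` and `√(-κ)` cover all three; the last one has content only for `κ < 0`,
  -- where it absorbs the size of the initial derivative uniformly in `κ`.
  rcases lt_trichotomy κ 0 with h | h | h
  · have hν : 0 < √(-κ) := Real.sqrt_pos.2 (by linarith)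
    have hν2 : √(-κ) ^ 2 = -κ := Real.sq_sqrt (by linarith)
    set ν := √(-κ)
    rw [Real.sqrt_eq_zero_of_nonpos h.le]
    have hl : ∀ u : ℝ, HasDerivAt (fun u => ν * u) ν u := fun u => by
      simpa using (hasDerivAt_id u).const_mul ν
    refine ⟨fun u => Real.cos (ν * u), fun u => Real.sin (ν * u) / ν, fun u => ?_, fun u => ?_,
      by simp, by simp, fun u hu => ?_, fun u hu => ?_, fun u hu => ?_⟩
    · refine ((hl u).sin.div_const ν).congr_deriv ?_
      field_simp
    · refine (hl u).cos.congr_deriv ?_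
      field_simp
      rw [hν2]
      ring
    · simpa using Real.abs_cos_le_one _
    · rw [abs_div, abs_of_pos hν, div_le_iff₀ hν, zero_mul, Real.exp_zero]
      have h1 := Real.abs_sin_le_abs (x := ν * u)
      rw [abs_mul, abs_of_pos hν, abs_of_nonneg hu] at h1
      linarith
    · rw [abs_div, abs_of_pos hν, mul_div_cancel₀ _ hν.ne', zero_mul, Real.exp_zero]
      exact Real.abs_sin_le_one _
  · subst h
    refine ⟨fun _ => 1, fun u => u, fun u => hasDerivAt_id u, fun u => ?_, rfl, rfl, ?_, ?_, ?_⟩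
    · simpa using hasDerivAt_const u (1 : ℝ)
    · intro u _; simp
    · intro u hu; simp [abs_of_nonneg hu]
    · intro u _; simp
  · have hμ : 0 < √κ := Real.sqrt_pos.2 h
    have hμ2 : √κ ^ 2 = κ := Real.sq_sqrt h.le
    rw [Real.sqrt_eq_zero_of_nonpos (by linarith : -κ ≤ 0)]
    set μ := √κ
    have hl : ∀ u : ℝ, HasDerivAt (fun u => μ * u) μ u := fun u => by
      simpa using (hasDerivAt_id u).const_mul μ
    refine ⟨fun u => Real.cosh (μ * u), fun u => Real.sinh (μ * u) / μ, fun u => ?_, fun u => ?_,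
      by simp, by simp, fun u hu => ?_, fun u hu => ?_, fun u hu => ?_⟩
    · refine ((hl u).sinh.div_const μ).congr_deriv ?_
      field_simp
    · refine (hl u).cosh.congr_deriv ?_
      field_simp
      rw [hμ2]
      ring
    · rw [abs_of_pos (Real.cosh_pos _), Real.cosh_eq]
      have h1 : Real.exp (-(μ * u)) ≤ Real.exp (μ * u) :=
        Real.exp_le_exp.2 (by nlinarith)
      linarith
    · have h0 : 0 ≤ μ * u := by positivity
      rw [abs_div, abs_of_pos hμ, div_le_iff₀ hμ, abs_of_nonneg (Real.sinh_nonneg_iff.2 h0)]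
      have := sinh_le_mul_exp (μ * u)
      linarith
    · rw [zero_mul]
      exact (Real.exp_pos _).le

/-- Decay bound for the recessive solutions of perturbations of `z'' = μ² z`. -/
theorem norm_le_of_perturbed_ode_of_tendsto {z z1 : ℝ → ℂ} {r : ℝ → ℝ} {A Z μ t : ℝ}
    (hμ : 1 ≤ μ) (hA : 0 ≤ A) (ht : 1 ≤ t)
    (hz : ∀ s, 1 ≤ s → HasDerivAt z (z1 s) s)
    (hz1 : ∀ s, 1 ≤ s → HasDerivAt z1 ((μ ^ 2 + r s) • z s) s)
    (hr : ∀ s, 1 ≤ s → ‖r s • z s‖ ≤ A * Real.exp (-s)) (hz0 : ‖z 1‖ ≤ Z)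
    (hlim : Tendsto (fun s => Real.exp (-(μ * s)) • (z1 s + μ • z s)) atTop (𝓝 0)) :
    ‖z t‖ ≤ Real.exp (-(t - 1)) * Z + A / 2 * (t - 1) * Real.exp (-t) := by
  have hl : ∀ u : ℝ, HasDerivAt (fun u => μ * u) μ u := fun u => by
    simpa using (hasDerivAt_id u).const_mul μ
  -- The operator factors as `(d/ds - μ)(d/ds + μ)`. The outer factor is integrated back from
  -- infinity, where `hlim` removes the growing mode; the inner one is integrated forward from `1`.
  have hg : ∀ s, 1 ≤ s → HasDerivAt (fun s => Real.exp (-(μ * s)) • (z1 s + μ • z s))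
      (Real.exp (-(μ * s)) • (r s • z s)) s := fun s hs => by
    refine ((hl s).fun_neg.exp.fun_smul ((hz1 s hs).fun_add
      ((hz s hs).fun_const_smul μ))).congr_deriv ?_
    module
  have hw : ∀ s, 1 ≤ s → ‖z1 s + μ • z s‖ ≤ A / 2 * Real.exp (-s) := by
    intro s hs
    have h1 : ∀ᶠ x in atTop, ‖Real.exp (-(μ * s)) • (z1 s + μ • z s)‖ ≤
        ‖Real.exp (-(μ * x)) • (z1 x + μ • z x)‖ +
          A / (1 + μ) * Real.exp (-((1 + μ) * s)) := by
      filter_upwards [eventually_ge_atTop s] with x hx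
      have h2 := norm_sub_le_of_hasDerivAt_le
        (B := fun x => -(A / (1 + μ)) * Real.exp (-((1 + μ) * x)))
        (B' := fun x => A * Real.exp (-((1 + μ) * x))) hx
        (fun y hy => hg y (hs.trans hy.1)) (fun y => ?_) (fun y hy => ?_)
      · have h3 := norm_sub_norm_le (Real.exp (-(μ * s)) • (z1 s + μ • z s))
          (Real.exp (-(μ * x)) • (z1 x + μ • z x))
        rw [norm_sub_rev] at h3
        have h4 : 0 ≤ A / (1 + μ) * Real.exp (-((1 + μ) * x)) := by positivity
        linarith
      · have h3 : HasDerivAt (fun x => -((1 + μ) * x)) (-(1 + μ)) y := by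
          simpa using ((hasDerivAt_id y).const_mul (1 + μ)).fun_neg
        refine (h3.exp.const_mul (-(A / (1 + μ)))).congr_deriv ?_
        field_simp
      · rw [norm_smul, Real.norm_eq_abs, abs_of_pos (Real.exp_pos _)]
        calc Real.exp (-(μ * y)) * ‖r y • z y‖ ≤ Real.exp (-(μ * y)) * (A * Real.exp (-y)) := by
              have := hr y (hs.trans hy.1)
              gcongr
          _ = A * (Real.exp (-(μ * y)) * Real.exp (-y)) := by ring
          _ = _ := by rw [← Real.exp_add]; ring_nf
    have h2 := ge_of_tendsto ((hlim.norm).add_const _) h1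
    rw [norm_zero, zero_add, norm_smul, Real.norm_eq_abs, abs_of_pos (Real.exp_pos _),
      show -((1 + μ) * s) = -(μ * s) + -s by ring, Real.exp_add] at h2
    have h3 : ‖z1 s + μ • z s‖ ≤ A / (1 + μ) * Real.exp (-s) := by
      refine le_of_mul_le_mul_left ?_ (Real.exp_pos (-(μ * s)))
      linarith
    refine h3.trans ?_
    gcongr
    linarith
  have hh : ∀ s, 1 ≤ s → HasDerivAt (fun s => Real.exp (μ * s) • z s)
      (Real.exp (μ * s) • (z1 s + μ • z s)) s := fun s hs => by
    refine ((hl s).exp.fun_smul (hz s hs)).congr_deriv ?_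
    module
  have h5 := norm_sub_le_of_hasDerivAt_le
    (B := fun x => A / 2 * Real.exp ((μ - 1) * t) * x)
    (B' := fun _ => A / 2 * Real.exp ((μ - 1) * t)) ht
    (fun y hy => hh y hy.1) (fun y => ?_) (fun y hy => ?_)
  · have h6 := norm_sub_norm_le (Real.exp (μ * t) • z t) (Real.exp (μ * 1) • z 1)
    rw [norm_smul, norm_smul, Real.norm_eq_abs, Real.norm_eq_abs, abs_of_pos (Real.exp_pos _),
      abs_of_pos (Real.exp_pos _)] at h6
    have h7 : Real.exp (μ * t) * ‖z t‖ ≤ Real.exp (μ * 1) * Z +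
        A / 2 * Real.exp ((μ - 1) * t) * (t - 1) := by
      have : Real.exp (μ * 1) * ‖z 1‖ ≤ Real.exp (μ * 1) * Z := by gcongr
      linarith
    have h8 : Real.exp (μ * 1) ≤ Real.exp (μ * t) * Real.exp (-(t - 1)) := by
      rw [← Real.exp_add, Real.exp_le_exp]
      nlinarith
    have h9 : Real.exp ((μ - 1) * t) = Real.exp (μ * t) * Real.exp (-t) := by
      rw [← Real.exp_add]; ring_nf
    have hZ : 0 ≤ Z := (norm_nonneg _).trans hz0
    refine le_of_mul_le_mul_left ?_ (Real.exp_pos (μ * t))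
    rw [h9] at h7
    nlinarith [mul_le_mul_of_nonneg_right h8 hZ]
  · simpa using (hasDerivAt_id y).const_mul (A / 2 * Real.exp ((μ - 1) * t))
  · rw [norm_smul, Real.norm_eq_abs, abs_of_pos (Real.exp_pos _)]
    calc Real.exp (μ * y) * ‖z1 y + μ • z y‖ ≤ Real.exp (μ * y) * (A / 2 * Real.exp (-y)) := by
          have := hw y hy.1
          gcongr
      _ = A / 2 * (Real.exp (μ * y) * Real.exp (-y)) := by ring
      _ = A / 2 * Real.exp ((μ - 1) * y) := by rw [← Real.exp_add]; ring_nf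
      _ ≤ A / 2 * Real.exp ((μ - 1) * t) := by
          have h1 : (μ - 1) * y ≤ (μ - 1) * t :=
            mul_le_mul_of_nonneg_left hy.2 (by linarith)
          gcongr

end Ratner

namespace Ratner

open Filter Topology

/-! ### Hyperbolic estimates and numerical constants -/

/-- The integrating factor of the radial equation. -/
noncomputable def weight (t : ℝ) : ℝ := √(2 * Real.sinh (2 * t))

/-- The first order coefficient of the radial equation. -/
noncomputable def radialCoth (t : ℝ) : ℝ := Real.cosh (2 * t) / Real.sinh (2 * t)

theorem sinh_two_mul_pos {t : ℝ} (ht : 0 < t) : 0 < Real.sinh (2 * t) :=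
  Real.sinh_pos_iff.2 (by linarith)

theorem weight_pos {t : ℝ} (ht : 0 < t) : 0 < weight t :=
  Real.sqrt_pos.2 (by linarith [sinh_two_mul_pos ht])

theorem weight_sq {t : ℝ} (ht : 0 < t) : weight t ^ 2 = 2 * Real.sinh (2 * t) :=
  Real.sq_sqrt (by linarith [sinh_two_mul_pos ht])

theorem hasDerivAt_two_mul (t : ℝ) : HasDerivAt (fun t : ℝ => 2 * t) 2 t := by
  simpa using (hasDerivAt_id t).const_mul (2 : ℝ)

theorem hasDerivAt_weight {t : ℝ} (ht : 0 < t) :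
    HasDerivAt weight (radialCoth t * weight t) t := by
  have hs := sinh_two_mul_pos ht
  have h := (((hasDerivAt_two_mul t).sinh).const_mul 2).sqrt (by positivity)
  refine h.congr_deriv ?_
  have hw := weight_pos ht
  have hw2 := weight_sq ht
  change _ / (2 * weight t) = _
  rw [radialCoth]
  field_simp
  rw [hw2]

theorem hasDerivAt_radialCoth {t : ℝ} (ht : 0 < t) :
    HasDerivAt radialCoth (2 * (1 - radialCoth t ^ 2)) t := by
  have hs := sinh_two_mul_pos ht
  have h := ((hasDerivAt_two_mul t).cosh).div ((hasDerivAt_two_mul t).sinh) hs.ne'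
  refine h.congr_deriv ?_
  rw [radialCoth]
  field_simp

theorem radialCoth_sq {t : ℝ} (ht : 0 < t) :
    radialCoth t ^ 2 = 1 + 1 / Real.sinh (2 * t) ^ 2 := by
  have hs := sinh_two_mul_pos ht
  rw [radialCoth]
  field_simp
  linarith [Real.cosh_sq_sub_sinh_sq (2 * t)]

theorem exp_neg_four_lt_one : Real.exp (-4) < 1 := by
  rw [Real.exp_lt_one_iff]; norm_num

theorem C1_pos : 0 < C1 := inv_pos.2 (by linarith [exp_neg_four_lt_one])

theorem one_le_C1 : 1 ≤ C1 := by
  rw [C1, one_le_inv₀ (by linarith [exp_neg_four_lt_one])]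
  linarith [Real.exp_pos (-4)]

theorem C2_eq : C2 = 2 * C1 * (1 + 2 * C1 * Real.exp (-2) + 2 * C1 * Real.exp (-4)) := by
  rw [C2, C1, Real.exp_neg 2, Real.exp_neg 4]
  have h : 1 - (Real.exp 4)⁻¹ ≠ 0 := by
    rw [← Real.exp_neg]; linarith [exp_neg_four_lt_one]
  have h2 := Real.exp_pos 2
  have h4 := Real.exp_pos 4
  generalize 1 - (Real.exp 4)⁻¹ = x at h ⊢
  field_simp

theorem C1_le : C1 ≤ 1.02 := by
  have he : (2.7 : ℝ) ≤ Real.exp 1 := by linarith [Real.exp_one_gt_d9]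
  have h4 : (51 : ℝ) ≤ Real.exp 4 := by
    rw [show (4 : ℝ) = ((4 : ℕ) : ℝ) * 1 by norm_num, Real.exp_nat_mul]
    calc (51 : ℝ) ≤ 2.7 ^ 4 := by norm_num
      _ ≤ _ := by gcongr
  have h5 : Real.exp (-4) ≤ 1 / 51 := by
    rw [Real.exp_neg, one_div]
    gcongr
  rw [C1]
  refine inv_le_of_inv_le₀ (by norm_num) ?_
  norm_num at h5 ⊢
  linarith

theorem C2_le : C2 ≤ 3 := by
  have he : (2.7 : ℝ) ≤ Real.exp 1 := by linarith [Real.exp_one_gt_d9]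
  have h2 : (7 : ℝ) ≤ Real.exp 2 := by
    rw [show (2 : ℝ) = ((2 : ℕ) : ℝ) * 1 by norm_num, Real.exp_nat_mul]
    calc (7 : ℝ) ≤ 2.7 ^ 2 := by norm_num
      _ ≤ _ := by gcongr
  have h3 : Real.exp (-2) ≤ 1 / 7 := by
    rw [Real.exp_neg, one_div]
    gcongr
  have h4 : Real.exp (-4) ≤ 1 / 49 := by
    rw [show (-4 : ℝ) = -2 + -2 by norm_num, Real.exp_add]
    nlinarith [Real.exp_pos (-2)]
  have h1 := C1_le
  have h0 := C1_pos
  rw [C2_eq]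
  calc 2 * C1 * (1 + 2 * C1 * Real.exp (-2) + 2 * C1 * Real.exp (-4))
      ≤ 2 * 1.02 * (1 + 2 * 1.02 * (1 / 7) + 2 * 1.02 * (1 / 49)) := by gcongr
    _ ≤ 3 := by norm_num

theorem C2_pos : 0 < C2 := by
  have := C1_pos
  rw [C2_eq]
  positivity

theorem sinh_two_mul_eq (t : ℝ) :
    2 * Real.sinh (2 * t) = Real.exp t ^ 2 * (1 - Real.exp (-4 * t)) := by
  have h1 : Real.exp t ^ 2 = Real.exp (2 * t) := by rw [← Real.exp_nat_mul]; norm_num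
  have h2 : Real.exp (-(2 * t)) = Real.exp (2 * t) * Real.exp (-4 * t) := by
    rw [← Real.exp_add]; ring_nf
  rw [Real.sinh_eq, h1, h2]
  ring

theorem exp_neg_four_mul_le {t : ℝ} (ht : 1 ≤ t) : Real.exp (-4 * t) ≤ Real.exp (-4) :=
  Real.exp_le_exp.2 (by linarith)

theorem C1_mul : C1 * (1 - Real.exp (-4)) = 1 :=
  inv_mul_cancel₀ (by linarith [exp_neg_four_lt_one])

theorem weight_le (t : ℝ) : weight t ≤ Real.exp t := by
  refine Real.sqrt_le_iff.2 ⟨(Real.exp_pos t).le, ?_⟩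
  rw [sinh_two_mul_eq]
  nlinarith [Real.exp_pos (-4 * t), sq_nonneg (Real.exp t)]

/-- `C1` is the value at `t = 1` of the decreasing function `1 / (1 - e^{-4t})`. -/
theorem exp_sq_le {t : ℝ} (ht : 1 ≤ t) : Real.exp t ^ 2 ≤ C1 * (2 * Real.sinh (2 * t)) := by
  have h2 := exp_neg_four_mul_le ht
  have h3 := C1_pos
  have h4 : C1 * (1 - Real.exp (-4)) ≤ C1 * (1 - Real.exp (-4 * t)) := by gcongr
  rw [C1_mul] at h4
  rw [sinh_two_mul_eq]
  nlinarith [sq_nonneg (Real.exp t)]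

theorem exp_le_weight {t : ℝ} (ht : 1 ≤ t) : Real.exp t ≤ C1 * weight t := by
  have h0 : 0 < t := by linarith
  have h1 := weight_sq h0
  have h3 := one_le_C1
  have hw := weight_pos h0
  refine (abs_le_of_sq_le_sq' (b := C1 * weight t) ?_ (by positivity)).2
  refine (exp_sq_le ht).trans ?_
  rw [mul_pow, h1]
  have hs := sinh_two_mul_pos h0
  have h4 : C1 ≤ C1 ^ 2 := by nlinarith
  gcongr

/-- The ratio `weight t / e^t` is increasing; using this for the initial term avoids a factor `C1`
there. -/
theorem weight_one_le {t : ℝ} (ht : 1 ≤ t) : weight 1 * Real.exp t ≤ Real.exp 1 * weight t := by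
  have h0 : 0 < t := by linarith
  have hw := weight_pos h0
  refine (abs_le_of_sq_le_sq' (b := Real.exp 1 * weight t) ?_ (by positivity)).2
  rw [mul_pow, mul_pow, weight_sq h0, weight_sq one_pos, sinh_two_mul_eq, sinh_two_mul_eq]
  have h2 := exp_neg_four_mul_le ht
  rw [mul_one]
  have h3 : 0 ≤ Real.exp 1 ^ 2 * Real.exp t ^ 2 := by positivity
  nlinarith

theorem radialCoth_le_two {t : ℝ} (ht : 1 ≤ t) : radialCoth t ≤ 2 := by
  have hs := sinh_two_mul_pos (by linarith : 0 < t)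
  rw [radialCoth, div_le_iff₀ hs, Real.sinh_eq, Real.cosh_eq]
  have h1 : Real.exp (-(2 * t)) ≤ 1 := Real.exp_le_one_iff.2 (by linarith)
  have h2 := Real.add_one_le_exp (2 * t)
  linarith

theorem radialCoth_pos {t : ℝ} (ht : 0 < t) : 0 < radialCoth t :=
  div_pos (Real.cosh_pos _) (sinh_two_mul_pos ht)

/-- The source of `C2`: the quotient is `1 / sinh · (1 / sinh + coth)`, and each piece is estimated
through `C1`. -/
theorem one_add_cosh_div_le {t : ℝ} (ht : 1 ≤ t) :
    (1 + Real.cosh (2 * t)) / Real.sinh (2 * t) ^ 2 ≤ C2 * Real.exp (-2 * t) := by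
  have h0 : 0 < t := by linarith
  have hs := sinh_two_mul_pos h0
  have hC := C1_pos
  have h1 : 1 / Real.sinh (2 * t) ≤ 2 * C1 * Real.exp (-2 * t) := by
    rw [div_le_iff₀ hs]
    have h2 := exp_sq_le ht
    have h3 : Real.exp t ^ 2 * Real.exp (-2 * t) = 1 := by
      rw [← Real.exp_nat_mul, ← Real.exp_add]; simp
    nlinarith [Real.exp_pos (-2 * t)]
  have h2 : Real.exp (-2 * t) ≤ Real.exp (-2) := Real.exp_le_exp.2 (by linarith)
  have h3 : radialCoth t ≤ 1 + 2 * C1 * Real.exp (-4) := by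
    have h4 : radialCoth t = 1 + Real.exp (-2 * t) * (1 / Real.sinh (2 * t)) := by
      rw [radialCoth]
      field_simp
      rw [Real.sinh_eq, Real.cosh_eq]
      ring_nf
    have h5 : Real.exp (-2 * t) * Real.exp (-2 * t) ≤ Real.exp (-4) := by
      rw [← Real.exp_add]
      exact Real.exp_le_exp.2 (by linarith)
    rw [h4]
    nlinarith [Real.exp_pos (-2 * t)]
  have h6 : (1 + Real.cosh (2 * t)) / Real.sinh (2 * t) ^ 2 =
      1 / Real.sinh (2 * t) * (1 / Real.sinh (2 * t) + radialCoth t) := by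
    rw [radialCoth]
    field_simp
  rw [h6, C2_eq]
  have h7 := radialCoth_pos h0
  calc 1 / Real.sinh (2 * t) * (1 / Real.sinh (2 * t) + radialCoth t)
      ≤ 2 * C1 * Real.exp (-2 * t) * (2 * C1 * Real.exp (-2) + (1 + 2 * C1 * Real.exp (-4))) := by
        gcongr
        exact h1.trans (by gcongr)
    _ = _ := by ring

/-- Bound for the potential of the radial equation. -/
theorem abs_potential_le {n m K t : ℝ} (ht : 1 ≤ t) (hK : n ^ 2 + m ^ 2 ≤ K)
    (hK1 : 1 - (n ^ 2 + m ^ 2) ≤ K) :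
    |(n ^ 2 + m ^ 2 - 1 - 2 * m * n * Real.cosh (2 * t)) / Real.sinh (2 * t) ^ 2| ≤
      K * C2 * Real.exp (-2 * t) := by
  have hs := sinh_two_mul_pos (by linarith : 0 < t)
  have hc := Real.cosh_pos (2 * t)
  have h2 := one_add_cosh_div_le ht
  have hK0 : 0 ≤ K := by nlinarith [sq_nonneg n, sq_nonneg m]
  -- Here `2|mn| ≤ n² + m²`. The second hypothesis on `K` handles the `-1`: later `K = n² + m² + 1`
  -- in general, and `K = n² + m²` once this is at least `1`.
  have h1 : |n ^ 2 + m ^ 2 - 1 - 2 * m * n * Real.cosh (2 * t)| ≤ K * (1 + Real.cosh (2 * t)) := by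
    rw [abs_le]
    constructor <;> nlinarith [sq_nonneg (n - m), sq_nonneg (n + m)]
  rw [abs_div, abs_of_pos (by positivity : 0 < Real.sinh (2 * t) ^ 2)]
  calc |n ^ 2 + m ^ 2 - 1 - 2 * m * n * Real.cosh (2 * t)| / Real.sinh (2 * t) ^ 2
      ≤ K * (1 + Real.cosh (2 * t)) / Real.sinh (2 * t) ^ 2 := by gcongr
    _ = K * ((1 + Real.cosh (2 * t)) / Real.sinh (2 * t) ^ 2) := by ring
    _ ≤ K * (C2 * Real.exp (-2 * t)) := by gcongr
    _ = _ := by ring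

end Ratner

namespace Ratner

open Filter Topology

/-! ### Bounds for matrix coefficients -/

/-! ### Liouville substitution: removing the first-order term of the radial equation -/

section Liouville

variable {y y1 y2 : ℝ → ℂ} {E q : ℝ} {t : ℝ}

theorem hasDerivAt_weight_smul (ht : 0 < t) (hy : HasDerivAt y (y1 t) t) :
    HasDerivAt (fun t => weight t • y t) (weight t • (y1 t + radialCoth t • y t)) t := by
  refine ((hasDerivAt_weight ht).fun_smul hy).congr_deriv ?_
  module

theorem hasDerivAt_weight_smul_deriv (ht : 0 < t) (hy : HasDerivAt y (y1 t) t)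
    (hy1 : HasDerivAt y1 (y2 t) t)
    (hode : y2 t = (E + q) • y t - (2 * radialCoth t) • y1 t) :
    HasDerivAt (fun t => weight t • (y1 t + radialCoth t • y t))
      ((1 + E + (q - 1 / Real.sinh (2 * t) ^ 2)) • (weight t • y t)) t := by
  refine ((hasDerivAt_weight ht).fun_smul
    (hy1.fun_add ((hasDerivAt_radialCoth ht).fun_smul hy))).congr_deriv ?_
  have hp : 1 / Real.sinh (2 * t) ^ 2 = radialCoth t ^ 2 - 1 := by rw [radialCoth_sq ht]; ring
  rw [hode, hp]
  module

/-- A bounded solution of the radial equation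
`y'' + 2 coth (2t) y' = (4 lam + (n² + m² - 2mn cosh (2t)) / sinh² (2t)) y`. -/
structure IsRadialSolution (n m lam : ℝ) (y y1 y2 : ℝ → ℂ) : Prop where
  hasDerivAt : ∀ t, HasDerivAt y (y1 t) t
  hasDerivAt_deriv : ∀ t, HasDerivAt y1 (y2 t) t
  ode : ∀ t, 0 < t → y2 t = (4 * lam + (n ^ 2 + m ^ 2 - 2 * m * n * Real.cosh (2 * t)) /
    Real.sinh (2 * t) ^ 2) • y t - (2 * radialCoth t) • y1 t
  norm_le : ∀ t, ‖y t‖ ≤ 1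

theorem IsRadialSolution.hasDerivAt_weight {n m lam : ℝ} (h : IsRadialSolution n m lam y y1 y2)
    (ht : 0 < t) :
    HasDerivAt (fun t => weight t • (y1 t + radialCoth t • y t))
      ((1 + 4 * lam + (n ^ 2 + m ^ 2 - 1 - 2 * m * n * Real.cosh (2 * t)) /
        Real.sinh (2 * t) ^ 2) • (weight t • y t)) t := by
  refine (hasDerivAt_weight_smul_deriv ht (h.hasDerivAt t) (h.hasDerivAt_deriv t)
    (h.ode t ht)).congr_deriv ?_
  congr 2
  ring

end Liouville

variable {H : Type*} [NormedAddCommGroup H] [InnerProductSpace ℂ H]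
  {T : SL(2, ℝ) →* (H ≃ₗᵢ[ℂ] H)} {lam : ℝ} {n m : ℤ} {v w : H}

theorem norm_inner_apply_le (hw1 : ‖w‖ ≤ 1) (g : SL(2, ℝ)) (u : H) :
    ‖(inner ℂ w (T g u) : ℂ)‖ ≤ ‖u‖ := by
  refine (norm_inner_le_norm _ _).trans ?_
  rw [LinearIsometryEquiv.norm_map]
  exact mul_le_of_le_one_left (norm_nonneg _) hw1

theorem isRadialSolution_inner_diag (hlam : IsCasimirParameter T lam) (hv : v ∈ kTypeSpace T m)
    (hv2 : IsCkVector T 2 v) (hv1 : ‖v‖ ≤ 1) (hw : w ∈ kTypeSpace T n) (hw1 : ‖w‖ ≤ 1) :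
    IsRadialSolution n m lam (fun t => inner ℂ w (T (diag t) v))
      (fun t => inner ℂ w (T (diag t) (lieDeriv T diag v)))
      (fun t => inner ℂ w (T (diag t) (lieDeriv T diag (lieDeriv T diag v)))) where
  hasDerivAt t := (hv2.mono one_le_two).hasDerivAt_inner_diag w t
  hasDerivAt_deriv t := (hv2.lieDeriv (k := 1) isOneParam_diag).hasDerivAt_inner_diag w t
  ode t ht := by
    rw [ode_of_isCasimirParameter hlam hv hv2 hw ht.ne', radialCoth, Complex.real_smul,
      Complex.real_smul]
    push_cast
    ring
  norm_le t := (norm_inner_apply_le hw1 _ _).trans hv1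

/-- The potential decays like `e^{-2t}` and the weight grows at most like `e^t`. The a priori bound
`‖y‖ ≤ 1` makes the perturbation a known integrable forcing term, so no Gronwall argument is needed.
-/
theorem norm_potential_smul_le {y : ℂ} (hy : ‖y‖ ≤ 1) {n m K t : ℝ} (ht : 1 ≤ t)
    (hK : n ^ 2 + m ^ 2 ≤ K) (hK1 : 1 - (n ^ 2 + m ^ 2) ≤ K) :
    ‖((n ^ 2 + m ^ 2 - 1 - 2 * m * n * Real.cosh (2 * t)) / Real.sinh (2 * t) ^ 2) •
      (weight t • y)‖ ≤ K * C2 * Real.exp (-t) := by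
  have h0 : 0 < t := by linarith
  have hw := weight_pos h0
  have h1 := abs_potential_le ht hK hK1
  have h2 := (abs_nonneg _).trans h1
  rw [norm_smul, norm_smul, Real.norm_eq_abs, Real.norm_eq_abs, abs_of_pos hw]
  have h3 : weight t * ‖y‖ ≤ Real.exp t * 1 :=
    mul_le_mul (weight_le t) hy (norm_nonneg _) (Real.exp_pos _).le
  calc _ ≤ K * C2 * Real.exp (-2 * t) * (Real.exp t * 1) :=
        mul_le_mul h1 h3 (by positivity) h2
    _ = K * C2 * (Real.exp (-2 * t) * Real.exp t) := by ring
    _ = _ := by rw [← Real.exp_add]; ring_nf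

theorem norm_le_of_norm_weight_smul_le {y : ℂ} {t X Y : ℝ} (ht : 1 ≤ t) (hX : 0 ≤ X) (hY : 0 ≤ Y)
    (h : ‖weight t • y‖ ≤ weight 1 * X + Y) :
    ‖y‖ ≤ Real.exp (-t) * (Real.exp 1 * X + C1 * Y) := by
  have hw := weight_pos (by linarith : 0 < t)
  rw [norm_smul, Real.norm_eq_abs, abs_of_pos hw] at h
  have h1 := mul_le_mul_of_nonneg_right (weight_one_le ht) hX
  have h2 := mul_le_mul_of_nonneg_right (exp_le_weight ht) hY
  have h3 : Real.exp (-t) * Real.exp t = 1 := by rw [← Real.exp_add]; simp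
  have h4 := mul_le_mul_of_nonneg_left h (Real.exp_pos t).le
  have h5 : Real.exp t * ‖y‖ ≤ Real.exp 1 * X + C1 * Y := by
    refine le_of_mul_le_mul_left ?_ hw
    nlinarith
  calc ‖y‖ = Real.exp (-t) * (Real.exp t * ‖y‖) := by rw [← mul_assoc, h3, one_mul]
    _ ≤ _ := by gcongr

/-- Write `m² - 4λ = (1 + m²) - (1 + 4λ)` and use `1 + m² ≤ (1 + m²/2)²`. Isolating `√(-(1 + 4λ))`
prepares its absorption by the last bound of `exists_fundamental_solution`. -/
theorem norm_lieDeriv_diag_le (hlam : IsCasimirParameter T lam) (hv : v ∈ kTypeSpace T m)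
    (hv2 : IsCkVector T 2 v) (hv1 : ‖v‖ ≤ 1) :
    ‖lieDeriv T diag v‖ ≤ 1 + (m : ℝ) ^ 2 / 2 + √(-(1 + 4 * lam)) := by
  have h := norm_lieDeriv_diag_sq_le hlam hv hv2
  have h1 : -(1 + 4 * lam) ≤ √(-(1 + 4 * lam)) ^ 2 := by
    rw [Real.sq_sqrt']
    exact le_max_left _ _
  have h2 := Real.sqrt_nonneg (-(1 + 4 * lam))
  have h3 : ‖v‖ ^ 2 ≤ 1 := pow_le_one₀ (norm_nonneg _) hv1
  by_cases h0 : 0 ≤ (m : ℝ) ^ 2 - 4 * lam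
  · refine (abs_le_of_sq_le_sq' (b := 1 + (m : ℝ) ^ 2 / 2 + √(-(1 + 4 * lam))) ?_
      (by positivity)).2
    nlinarith [sq_nonneg (m : ℝ), sq_nonneg ((m : ℝ) ^ 2)]
  · have : ‖lieDeriv T diag v‖ ^ 2 ≤ 0 := h.trans (by nlinarith [sq_nonneg ‖v‖])
    have h4 : ‖lieDeriv T diag v‖ = 0 := by
      nlinarith [norm_nonneg (lieDeriv T diag v)]
    rw [h4]
    positivity

/-- The bound for solutions of the radial equation with arbitrary parameter. -/
theorem IsRadialSolution.norm_le_of_norm_deriv_le {n m lam D : ℝ} {y y1 y2 : ℝ → ℂ}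
    (h : IsRadialSolution n m lam y y1 y2) (hD : ‖y1 1‖ ≤ D)
    (hDle : D ≤ 1 + m ^ 2 / 2 + √(-(1 + 4 * lam))) {t : ℝ} (ht : 1 ≤ t) :
    ‖y t‖ ≤ (Real.exp 1 * (3 + m ^ 2 / 2) + C1 * C2 * (n ^ 2 + m ^ 2 + 1) * Real.exp (-1)) *
        (t * Real.exp ((-1 + √(1 + 4 * lam)) * t)) := by
  set N := n ^ 2 + m ^ 2 with hN
  have hN0 : 0 ≤ N := by positivity
  set κ := 1 + 4 * lam with hκ
  have hD0 : 0 ≤ D := (norm_nonneg _).trans hD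
  obtain ⟨c, S, hS, hc, hS0, hc0, hcb, hSb, hSb'⟩ := exists_fundamental_solution (κ := κ)
  have hC2 := C2_pos
  have hC1 := C1_pos
  have hw0 := weight_pos one_pos
  have key := norm_le_of_perturbed_ode (z := fun s => weight s • y s)
    (z1 := fun s => weight s • (y1 s + radialCoth s • y s))
    (r := fun s => (n ^ 2 + m ^ 2 - 1 - 2 * m * n * Real.cosh (2 * s)) / Real.sinh (2 * s) ^ 2)
    -- The initial derivative is at most `weight 1` times `D + 2 ≤ (3 + m²/2) + √(-κ)`. The first
    -- summand gives `α`; the second, multiplied by `|S u|`, is at most `e^{√κ u}` and gives `β =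
    -- 1`.
    (A := (N + 1) * C2) (Z := weight 1) (α := 3 + m ^ 2 / 2) (β := 1)
    (Real.sqrt_nonneg κ) (by positivity) ht
    (fun s hs => hasDerivAt_weight_smul (by linarith) (h.hasDerivAt s))
    (fun s hs => h.hasDerivAt_weight (by linarith))
    (fun s hs => norm_potential_smul_le (h.norm_le s) hs (by linarith) (by linarith))
    hS hc hS0 hc0 hcb hSb ?_ ?_
  · have hμ := Real.sqrt_nonneg κ
    have ht1 : 0 ≤ t - 1 := by linarith
    set e := Real.exp (√κ * (t - 1)) with he
    have hpos := Real.exp_pos (√κ * (t - 1))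
    have h1 := norm_le_of_norm_weight_smul_le ht
      (X := e * (1 + (3 + m ^ 2 / 2) * (t - 1) + 1))
      (Y := e * ((t - 1) * ((N + 1) * C2) * Real.exp (-1))) (by positivity) (by positivity)
      (key.trans (le_of_eq (by ring)))
    have h2 : e ≤ Real.exp (√κ * t) := Real.exp_le_exp.2 (by nlinarith)
    have h3 : 1 + (3 + m ^ 2 / 2) * (t - 1) + 1 ≤ (3 + m ^ 2 / 2) * t := by
      nlinarith [sq_nonneg m]
    have h4 : Real.exp ((-1 + √κ) * t) = Real.exp (-t) * Real.exp (√κ * t) := by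
      rw [← Real.exp_add]; ring_nf
    refine h1.trans ?_
    rw [h4]
    calc Real.exp (-t) * (Real.exp 1 * (e * (1 + (3 + m ^ 2 / 2) * (t - 1) + 1)) +
          C1 * (e * ((t - 1) * ((N + 1) * C2) * Real.exp (-1))))
        ≤ Real.exp (-t) * (Real.exp 1 * (Real.exp (√κ * t) * ((3 + m ^ 2 / 2) * t)) +
          C1 * (Real.exp (√κ * t) * (t * ((N + 1) * C2) * Real.exp (-1)))) := by
          gcongr
          linarith
      _ = _ := by ring
  · rw [norm_smul, Real.norm_eq_abs, abs_of_pos hw0]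
    exact mul_le_of_le_one_right hw0.le (h.norm_le 1)
  · intro u hu
    have h1 : ‖y1 1 +
        radialCoth 1 • y 1‖ ≤ D + 2 := by
      refine (norm_add_le _ _).trans (add_le_add hD ?_)
      rw [norm_smul, Real.norm_eq_abs, abs_of_pos (radialCoth_pos one_pos)]
      have := radialCoth_le_two le_rfl
      have h2 := h.norm_le 1
      have h3 := radialCoth_pos one_pos
      nlinarith [norm_nonneg (y 1)]
    rw [norm_smul, norm_smul, Real.norm_eq_abs, Real.norm_eq_abs, abs_of_pos hw0]
    have h2 : |S u| * (D + 2) ≤ ((3 + m ^ 2 / 2) * u + 1) * Real.exp (√κ * u) := by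
      calc |S u| * (D + 2) ≤ |S u| * (1 + m ^ 2 / 2 + √(-κ) + 2) := by gcongr
        _ = (3 + m ^ 2 / 2) * |S u| + √(-κ) * |S u| := by ring
        _ ≤ (3 + m ^ 2 / 2) * (u * Real.exp (√κ * u)) + Real.exp (√κ * u) := by
          have := hSb u hu
          have := hSb' u hu
          gcongr
        _ = _ := by ring
    calc |S u| * (weight 1 * _) ≤ |S u| * (weight 1 * (D + 2)) := by gcongr
      _ = weight 1 * (|S u| * (D + 2)) := by ring
      _ ≤ _ := by gcongr

/-- The `K`-types of non-trivial representations with non-negative Casimir parameter are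
non-zero. -/
theorem one_le_kType_sq [CompleteSpace H] (hT : IsStronglyContinuous T)
    (hirr : IsIrreducible T) (hnontriv : ∃ g : SL(2, ℝ), T g ≠ 1) (hlam : IsCasimirParameter T lam)
    (h0 : 0 ≤ lam) (hv : v ∈ kTypeSpace T m) (hv2 : IsCkVector T 2 v) (hv0 : v ≠ 0) :
    1 ≤ (m : ℝ) ^ 2 := by
  -- For `m = 0` and `λ ≥ 0` the Casimir bound forces `L_Q v = 0`, so `⟨v, T(a(t)) v⟩` is constant,
  -- contradicting its decay.
  have hm : m ≠ 0 := by
    rintro rfl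
    have h1 := norm_lieDeriv_diag_sq_le hlam hv hv2
    have h2 : ‖lieDeriv T diag v‖ = 0 := by
      have h3 : ‖lieDeriv T diag v‖ ^ 2 ≤ 0 := h1.trans (by
        push_cast
        nlinarith [sq_nonneg ‖v‖])
      nlinarith [norm_nonneg (lieDeriv T diag v)]
    have h3 : ∀ t, HasDerivAt (fun t => inner ℂ v (T (diag t) v)) 0 t := fun t => by
      have h4 := (hv2.mono one_le_two).hasDerivAt_inner_diag v t
      rwa [norm_eq_zero.1 h2, map_zero, inner_zero_right] at h4
    have h4 : ∀ t, inner ℂ v (T (diag t) v) = inner ℂ v v := fun t => by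
      rw [is_const_of_deriv_eq_zero (fun t => (h3 t).differentiableAt) (fun t => (h3 t).deriv) t 0,
        isOneParam_diag.zero, map_one]
      rfl
    have h5 := tendsto_inner_diag_atTop hT hirr hnontriv v v
    simp only [h4] at h5
    exact hv0 (inner_self_eq_zero.1 (tendsto_nhds_unique tendsto_const_nhds h5))
  have h1 : (1 : ℤ) ≤ m ^ 2 := by
    have := sq_pos_of_ne_zero hm
    omega
  exact_mod_cast h1

/-- The bound for decaying solutions of the radial equation with non-negative parameter. -/
theorem IsRadialSolution.norm_le_of_tendsto {n m lam : ℝ} {y y1 y2 : ℝ → ℂ}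
    (h : IsRadialSolution n m lam y y1 y2) (h0 : 0 ≤ lam) (hm : 1 ≤ m ^ 2)
    (hy0 : Tendsto y atTop (𝓝 0)) (hy1 : Tendsto y1 atTop (𝓝 0)) {t : ℝ} (ht : 1 ≤ t) :
    ‖y t‖ ≤ (Real.exp 2 + C1 * C2 * (n ^ 2 + m ^ 2) / 2 * (t - 1)) * Real.exp (-2 * t) := by
  set N := n ^ 2 + m ^ 2 with hN
  have hN1 : 1 ≤ N := by nlinarith [sq_nonneg n]
  set μ := √(1 + 4 * lam) with hμ
  have hμ1 : 1 ≤ μ := Real.one_le_sqrt.2 (by linarith)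
  have hμ2 : μ ^ 2 = 1 + 4 * lam := Real.sq_sqrt (by linarith)
  have hC2 := C2_pos
  have hC1 := C1_pos
  have hw0 := weight_pos one_pos
  have key := norm_le_of_perturbed_ode_of_tendsto
    (z := fun s => weight s • y s)
    (z1 := fun s => weight s • (y1 s + radialCoth s • y s))
    (r := fun s => (n ^ 2 + m ^ 2 - 1 - 2 * m * n * Real.cosh (2 * s)) / Real.sinh (2 * s) ^ 2)
    (A := N * C2) (Z := weight 1) hμ1 (by positivity) ht
    (fun s hs => hasDerivAt_weight_smul (by linarith) (h.hasDerivAt s))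
    (fun s hs => hμ2 ▸ h.hasDerivAt_weight (by linarith))
    (fun s hs => norm_potential_smul_le (h.norm_le s) hs (by linarith) (by linarith)) ?_ ?_
  · have ht1 : 0 ≤ t - 1 := by linarith
    have h1 := norm_le_of_norm_weight_smul_le ht (X := Real.exp (-(t - 1)))
      (Y := N * C2 / 2 * (t - 1) * Real.exp (-t)) (by positivity) (by positivity)
      (key.trans (le_of_eq (by ring)))
    refine h1.trans (le_of_eq ?_)
    have h2 : Real.exp (-2 * t) = Real.exp (-t) * Real.exp (-t) := by
      rw [← Real.exp_add]; ring_nf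
    have h3 : Real.exp (-(t - 1)) = Real.exp 1 * Real.exp (-t) := by
      rw [← Real.exp_add]; ring_nf
    have h4 : Real.exp 2 = Real.exp 1 * Real.exp 1 := by
      rw [← Real.exp_add]; norm_num
    rw [h2, h3, h4]
    ring
  · rw [norm_smul, Real.norm_eq_abs, abs_of_pos hw0]
    exact mul_le_of_le_one_right hw0.le (h.norm_le 1)
  · have h1 := hy1.norm
    have h2 := hy0.norm.const_mul (2 + μ)
    have h3 := h1.add h2
    rw [norm_zero, mul_zero, add_zero] at h3
    refine squeeze_zero_norm' ?_ h3
    filter_upwards [eventually_ge_atTop 1] with s hs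
    have hs0 : 0 < s := by linarith
    have hws := weight_pos hs0
    rw [norm_smul, Real.norm_eq_abs, abs_of_pos (Real.exp_pos _)]
    have h4 : weight s • (y1 s + radialCoth s • y s) + μ • weight s • y s =
        weight s • (y1 s + (radialCoth s + μ) • y s) := by module
    have h5 : ‖y1 s + (radialCoth s + μ) • y s‖ ≤ ‖y1 s‖ + (2 + μ) * ‖y s‖ := by
      refine (norm_add_le _ _).trans ?_
      have h6 := radialCoth_pos hs0
      have h7 := radialCoth_le_two hs
      rw [norm_smul, Real.norm_eq_abs, abs_of_pos (by linarith)]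
      gcongr
    -- Since `μ ≥ 1`, the factor `e^{-μ s}` compensates the weight, and the decay of `y` and `y1`
    -- alone kills the growing mode.
    have h8 : Real.exp (-(μ * s)) * weight s ≤ 1 := by
      calc Real.exp (-(μ * s)) * weight s ≤ Real.exp (-(μ * s)) * Real.exp s := by
            have := weight_le s
            gcongr
        _ = Real.exp (-(μ * s) + s) := by rw [Real.exp_add]
        _ ≤ 1 := Real.exp_le_one_iff.2 (by nlinarith)
    rw [h4, norm_smul, Real.norm_eq_abs, abs_of_pos hws, ← mul_assoc]
    calc Real.exp (-(μ * s)) * weight s * ‖y1 s + (radialCoth s + μ) • y s‖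
        ≤ 1 * ‖y1 s + (radialCoth s + μ) • y s‖ := by gcongr
      _ ≤ _ := by rw [one_mul]; exact h5

/-! ### Comparison with the explicit constants -/

/-- The required constants leave room: `C1 C2 / e ≤ 1.224`, whereas `(1 + 2√2) e` and `3e + e²`
exceed `3e` by more than that. -/
theorem C1_mul_C2_mul_le {N m : ℝ} (hm : m ^ 2 ≤ N) (hlam : lam < 0) :
    Real.exp 1 * (3 + m ^ 2 / 2) + C1 * C2 * (N + 1) * Real.exp (-1) ≤
      Kbar lam * N + Ktilde lam := by
  have hN : 0 ≤ N := (sq_nonneg m).trans hm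
  have hC1 := C1_pos
  have hC1' := C1_le
  have hC2 := C2_pos
  have hC2' := C2_le
  have he : (2.7 : ℝ) ≤ Real.exp 1 := by linarith [Real.exp_one_gt_d9]
  have hei : Real.exp (-1) = (Real.exp 1)⁻¹ := Real.exp_neg 1
  have hepos := Real.exp_pos (-1)
  have hei' : Real.exp (-1) ≤ 0.4 := by
    rw [hei]
    exact inv_le_of_inv_le₀ (by norm_num) (by norm_num at he ⊢; linarith)
  have hK : C1 * C2 * Real.exp (-1) + Real.exp 1 / 2 ≤ Kbar lam := by
    have h1 : 2 * C2 / Real.exp 1 = 2 * C2 * Real.exp (-1) := by rw [hei]; ring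
    have h2 : 0 ≤ 4 * C1 / (9 * Real.exp 3) := by positivity
    have h3 : C1 * (C2 * Real.exp (-1)) ≤ 2 * (C2 * Real.exp (-1)) := by
      gcongr
      linarith
    rw [Kbar, if_pos hlam, h1]
    linarith
  have h4 : C1 * C2 * Real.exp (-1) ≤ 1.224 := by
    calc C1 * C2 * Real.exp (-1) ≤ 1.02 * 3 * 0.4 := by gcongr
      _ = 1.224 := by norm_num
  have hKt : 3 * Real.exp 1 + C1 * C2 * Real.exp (-1) ≤ Ktilde lam := by
    rw [Ktilde]
    split_ifs with h
    · have h5 : (1.4 : ℝ) ≤ √2 := Real.le_sqrt_of_sq_le (by norm_num)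
      have h6 : 0 ≤ (32 + √2) * C1 ^ 2 / (3 * Real.exp 3) := by positivity
      nlinarith
    · have h6 : 0 ≤ 4 * C1 / (9 * Real.exp 3) := by positivity
      have h7 : Real.exp 1 ≤ Real.exp 2 := Real.exp_le_exp.2 (by norm_num)
      linarith
  have h8 := mul_le_mul_of_nonneg_right hK hN
  have h9 := mul_le_mul_of_nonneg_left hm (Real.exp_pos 1).le
  linarith

theorem Kbar_nonneg (lam : ℝ) : 0 ≤ Kbar lam := by
  have hC1 := C1_pos
  have hC2 := C2_pos
  unfold Kbar
  split_ifs <;> positivity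

theorem Ktilde_nonneg (lam : ℝ) : 0 ≤ Ktilde lam := by
  have hC1 := C1_pos
  unfold Ktilde
  split_ifs <;> positivity

theorem b_nonneg (lam : ℝ) {t : ℝ} (ht : 1 ≤ t) : 0 ≤ b lam t := by
  have : 0 ≤ t := by linarith
  unfold b
  split_ifs <;> positivity

end Ratner

/-! ### The main theorem -/

theorem lemma4p1 {H : Type*} [NormedAddCommGroup H] [InnerProductSpace ℂ H] [CompleteSpace H]
    [TopologicalSpace.SeparableSpace H]
    (T : SL(2, ℝ) →* (H ≃ₗᵢ[ℂ] H)) (hcont : Ratner.IsStronglyContinuous T)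
    (hirr : Ratner.IsIrreducible T) (hnontriv : ∃ g : SL(2, ℝ), T g ≠ 1)
    (φ : ℤ → H) (hφ : Ratner.IsKTypeBasis T φ) :
    (∃! lam : ℝ, Ratner.IsCasimirParameter T lam) ∧
    ∀ lam : ℝ, Ratner.IsCasimirParameter T lam →
      ∀ (n m : ℤ) (t : ℝ), 1 ≤ t →
        ‖Ratner.coeff T φ n m t‖ ≤
          (Ratner.Kbar lam * ((m : ℝ) ^ 2 + (n : ℝ) ^ 2) + Ratner.Ktilde lam) *
            Ratner.b lam t := by
  refine ⟨Ratner.existsUnique_isCasimirParameter hcont hirr hφ, fun lam hlam n m t ht => ?_⟩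
  have hC := Ratner.isCkVector_of_isKTypeBasis hcont hφ 2 m
  have hm1 := Ratner.norm_le_one_of_isKTypeBasis hφ m
  have hn1 := Ratner.norm_le_one_of_isKTypeBasis hφ n
  have hb := Ratner.b_nonneg lam ht
  rw [Ratner.coeff]
  rcases lt_or_ge lam 0 with h | h
  · refine ((Ratner.isRadialSolution_inner_diag hlam (hφ.mem m) hC hm1 (hφ.mem n)
      hn1).norm_le_of_norm_deriv_le (Ratner.norm_inner_apply_le hn1 _ _)
      (Ratner.norm_lieDeriv_diag_le hlam (hφ.mem m) hC hm1) ht).trans ?_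
    have h1 := Ratner.C1_mul_C2_mul_le (lam := lam) (N := (n : ℝ) ^ 2 + (m : ℝ) ^ 2) (m := m)
      (by nlinarith [sq_nonneg (n : ℝ)]) h
    -- The square root vanishes for `λ ≤ -1/4`, so a single formula covers both negative branches of
    -- `b`.
    have h2 : t * Real.exp ((-1 + √(1 + 4 * lam)) * t) = Ratner.b lam t := by
      rw [Ratner.b]
      split_ifs with h3
      · rw [Real.sqrt_eq_zero_of_nonpos (by linarith)]
        ring_nf
      · rfl
    rw [h2, add_comm ((m : ℝ) ^ 2)]
    gcongr
  · by_cases h0 : φ m = 0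
    · rw [h0, map_zero, inner_zero_right, norm_zero]
      have := Ratner.Kbar_nonneg lam
      have := Ratner.Ktilde_nonneg lam
      positivity
    refine ((Ratner.isRadialSolution_inner_diag hlam (hφ.mem m) hC hm1 (hφ.mem n)
      hn1).norm_le_of_tendsto h
      (Ratner.one_le_kType_sq hcont hirr hnontriv hlam h (hφ.mem m) hC h0)
      -- Decay is needed for the coefficient of `φ m` and for its derivative, which is the
      -- coefficient of `L_Q φ m`.
      (Ratner.tendsto_inner_diag_atTop hcont hirr hnontriv _ _)
      (Ratner.tendsto_inner_diag_atTop hcont hirr hnontriv _ _) ht).trans ?_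
    rw [Ratner.b, if_neg (by linarith), if_neg (by linarith), Ratner.Kbar, if_neg (by linarith),
      Ratner.Ktilde, if_neg (by linarith), if_neg (by linarith), ← mul_assoc]
    have hC1 := Ratner.C1_le
    have hC1' := Ratner.C1_pos
    have hC2 := Ratner.C2_le
    have hC2' := Ratner.C2_pos
    -- Equivalent to `(C1 - 1)(C2 - 1) ≤ 1`, which holds because `C1` is close to `1` and `C2 ≤ 3`.
    have h1 : Ratner.C1 * Ratner.C2 ≤ Ratner.C1 + Ratner.C2 := by
      nlinarith [Ratner.one_le_C1]
    have h2 : 0 ≤ ((n : ℝ) ^ 2 + (m : ℝ) ^ 2) / 2 * (t - 1) := by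
      have : 0 ≤ t - 1 := by linarith
      positivity
    have h3 := mul_le_mul_of_nonneg_right h1 h2
    have h4 : 0 ≤ (Ratner.C1 + Ratner.C2) * (((n : ℝ) ^ 2 + (m : ℝ) ^ 2) / 2) := by positivity
    have h5 : Real.exp 2 ≤ Real.exp 2 * t := le_mul_of_one_le_right (Real.exp_pos 2).le ht
    gcongr
    linarith
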